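/- Let $k$ be an algebraically closed field of characteristic zero, let $n\ge 5$, and let $H=\langle (1\,2),(3\,4)\rangle\cong\mathbb Z_2\times\mathbb Z_2\subset \mathbb S_n$, with character group $\widehat H=\mathrm{Hom}(H,k^\times)$. Let $\omega:\widehat H\times\widehat H\to k^\times$ be a normalized $2$-cocycle (trivial action, $\omega(1,\alpha)=\omega(\alpha,1)=1$) that is not a coboundary; up to coboundaries there is exactly one such $\omega$. For $\chi\in\widehat H$ put $e_\chi=\frac1{|H|}\sum_{h\in H}\chi(h^{-1})h\in k\mathbb S_n$, and let $$J=\sum_{\alpha,\beta\in\widehat H}\omega(\alpha,\beta)\,e_\alpha\otimes e_\beta\in k\mathbb S_n\otimes k\mathbb S_n .$$ Then $J$ is a twist, i.e. $J$ is invertible, $(\Delta\otimes \mathrm{id})(J)(J\otimes 1)=(\mathrm{id}\otimes\Delta)(J)(1\otimes J)$ and $(\varepsilon\otimes\mathrm{id})(J)=(\mathrm{id}\otimes\varepsilon)(J)=1$. Let $(k\mathbb S_n)^J$ be the Hopf algebra with the algebra structure and counit of the group algebra $k\mathbb S_n$, comultiplication $\Delta^J(h)=J^{-1}\Delta(h)J$,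 and antipode $S^J(h)=v^{-1}S(h)v$, where $v=m(S\otimes\mathrm{id})(J)$. Then $(k\mathbb S_n)^J$ is simple as a Hopf algebra: it is not $k1$, and its only normal Hopf subalgebras, i.e. Hopf subalgebras $K$ stable under the left adjoint action ($\sum h_1xS^J(h_2)\in K$ for all $h\in (k\mathbb S_n)^J$, $x\in K$, where $\Delta^J(h)=\sum h_1\otimes h_2$), are $k1$ and $(k\mathbb S_n)^J$ itself. -/

import Mathlib

open scoped TensorProduct

section TwistDefs

variable (k A : Type*) [Field k] [Ring A] [HopfAlgebra k A]

/-- A (Drinfeld) twist in a Hopf algebra `A` over `k`: an invertible `J ∈ A ⊗ A` with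
`(Δ ⊗ id)(J) (J ⊗ 1) = (id ⊗ Δ)(J) (1 ⊗ J)` (as elements of `A ⊗ (A ⊗ A)`) and
`(ε ⊗ id)(J) = 1 = (id ⊗ ε)(J)`. -/
structure HopfTwist where
  /-- the element `J` together with its inverse -/
  J : (A ⊗[k] A)ˣ
  cocycle :
    Algebra.TensorProduct.assoc k k k A A A
      (Algebra.TensorProduct.map (Bialgebra.comulAlgHom k A) (AlgHom.id k A) (J : A ⊗[k] A)
        * ((J : A ⊗[k] A) ⊗ₜ[k] (1 : A)))
    = Algebra.TensorProduct.map (AlgHom.id k A) (Bialgebra.comulAlgHom k A) (J : A ⊗[k] A)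
        * ((1 : A) ⊗ₜ[k] (J : A ⊗[k] A))
  counit_left :
    Algebra.TensorProduct.map (Bialgebra.counitAlgHom k A) (AlgHom.id k A) (J : A ⊗[k] A) = 1
  counit_right :
    Algebra.TensorProduct.map (AlgHom.id k A) (Bialgebra.counitAlgHom k A) (J : A ⊗[k] A) = 1

/-- The linear map `A ⊗ A → A`, `a ⊗ b ↦ a x S(b)`. -/
noncomputable def sandwichRight (x : A) : A ⊗[k] A →ₗ[k] A :=
  LinearMap.mul' k A ∘ₗ
    TensorProduct.map (LinearMap.mulRight k x) (HopfAlgebra.antipode k (A := A))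

/-- The linear map `A ⊗ A → A`, `a ⊗ b ↦ S(a) x b`. -/
noncomputable def sandwichLeft (x : A) : A ⊗[k] A →ₗ[k] A :=
  LinearMap.mul' k A ∘ₗ
    TensorProduct.map (LinearMap.mulRight k x ∘ₗ HopfAlgebra.antipode k (A := A)) LinearMap.id

variable {A}

/-- The left adjoint action `(h, x) ↦ ∑ h₁ x S(h₂)` of a Hopf algebra on itself. -/
noncomputable def hopfAdjoint (h x : A) : A :=
  sandwichRight k A x (Coalgebra.comul (R := k) h)

variable (A)

/-- A Hopf subalgebra: a unital subalgebra `K` with `Δ(K) ⊆ K ⊗ K` and `S(K) ⊆ K`. -/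
structure HopfSubalgebra extends Subalgebra k A where
  comul_mem : ∀ x ∈ carrier, Coalgebra.comul (R := k) x ∈
    LinearMap.range (TensorProduct.map toSubalgebra.val.toLinearMap toSubalgebra.val.toLinearMap)
  antipode_mem : ∀ x ∈ carrier, HopfAlgebra.antipode k x ∈ carrier

variable {k A} in
/-- A Hopf subalgebra is normal if it is stable under the left adjoint action. -/
def HopfSubalgebra.IsNormal (K : HopfSubalgebra k A) : Prop :=
  ∀ h : A, ∀ x ∈ K.toSubalgebra, hopfAdjoint k h x ∈ K.toSubalgebra

/-- `A` is simple as a Hopf algebra: `A ≠ k 1`, and the only normal Hopf subalgebras of `A` are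
`k 1` and `A`. -/
def IsSimpleHopfAlgebra : Prop :=
  (⊥ : Subalgebra k A) ≠ ⊤ ∧
    ∀ K : HopfSubalgebra k A, K.IsNormal → K.toSubalgebra = ⊥ ∨ K.toSubalgebra = ⊤

end TwistDefs

namespace HopfTwist

variable {k A : Type*} [Field k] [Ring A] [HopfAlgebra k A]

theorem sandwichRight_tmul (x a b : A) :
    sandwichRight k A x (a ⊗ₜ b) = a * x * HopfAlgebra.antipode k b := by
  simp [sandwichRight]

theorem sandwichLeft_tmul (x a b : A) :
    sandwichLeft k A x (a ⊗ₜ b) = HopfAlgebra.antipode k a * x * b := by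
  simp [sandwichLeft]

theorem sandwichLeft_mul (x : A) (X Y : A ⊗[k] A) :
    sandwichLeft k A x (X * Y) = sandwichLeft k A (sandwichLeft k A x X) Y := by
  induction Y using TensorProduct.induction_on with
  | zero => simp
  | add Y₁ Y₂ h₁ h₂ => simp [mul_add, h₁, h₂]
  | tmul c d =>
    rw [sandwichLeft_tmul]
    induction X using TensorProduct.induction_on with
    | zero => simp
    | add X₁ X₂ h₁ h₂ => simp [add_mul, mul_add, h₁, h₂]
    | tmul a b =>
      simp [sandwichLeft_tmul, HopfAlgebra.antipode_mul_antidistrib, mul_assoc]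

theorem sandwichRight_mul (x : A) (X Y : A ⊗[k] A) :
    sandwichRight k A x (X * Y) = sandwichRight k A (sandwichRight k A x Y) X := by
  induction X using TensorProduct.induction_on with
  | zero => simp
  | add Y₁ Y₂ h₁ h₂ => simp [add_mul, h₁, h₂]
  | tmul c d =>
    rw [sandwichRight_tmul]
    induction Y using TensorProduct.induction_on with
    | zero => simp
    | add X₁ X₂ h₁ h₂ => simp [add_mul, mul_add, h₁, h₂]
    | tmul a b =>
      simp [sandwichRight_tmul, HopfAlgebra.antipode_mul_antidistrib, mul_assoc]

theorem sandwichLeft_comul (h : A) :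
    sandwichLeft k A 1 (Coalgebra.comul (R := k) h) = algebraMap k A (Coalgebra.counit h) := by
  rw [← HopfAlgebra.mul_antipode_rTensor_comul_apply]
  have : LinearMap.mulRight k (1 : A) = LinearMap.id := by ext; simp
  simp [sandwichLeft, this, LinearMap.rTensor]

theorem sandwichRight_comul (h : A) :
    sandwichRight k A 1 (Coalgebra.comul (R := k) h) = algebraMap k A (Coalgebra.counit h) := by
  rw [← HopfAlgebra.mul_antipode_lTensor_comul_apply]
  have : LinearMap.mulRight k (1 : A) = LinearMap.id := by ext; simp
  simp [sandwichRight, this, LinearMap.lTensor]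

theorem sandwichLeft_algebraMap (c : k) (X : A ⊗[k] A) :
    sandwichLeft k A (algebraMap k A c) X = c • sandwichLeft k A 1 X := by
  induction X using TensorProduct.induction_on with
  | zero => simp
  | add X₁ X₂ h₁ h₂ => simp [h₁, h₂]
  | tmul a b => simp [sandwichLeft_tmul, ← Algebra.commutes c, ← Algebra.smul_def]

theorem sandwichRight_algebraMap (c : k) (X : A ⊗[k] A) :
    sandwichRight k A (algebraMap k A c) X = c • sandwichRight k A 1 X := by
  induction X using TensorProduct.induction_on with
  | zero => simp
  | add X₁ X₂ h₁ h₂ => simp [h₁, h₂]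
  | tmul a b => simp [sandwichRight_tmul, ← Algebra.commutes c, ← Algebra.smul_def]

theorem sandwichLeft_one : sandwichLeft k A 1 (1 : A ⊗[k] A) = 1 := by
  simp [Algebra.TensorProduct.one_def, sandwichLeft_tmul]

theorem sandwichRight_one : sandwichRight k A 1 (1 : A ⊗[k] A) = 1 := by
  simp [Algebra.TensorProduct.one_def, sandwichRight_tmul]

variable (T : HopfTwist k A)

/-- The element `v = m (S ⊗ id) (J)`. -/
noncomputable def v : A := sandwichLeft k A 1 (T.J : A ⊗[k] A)

/-- The element `m (id ⊗ S) (J⁻¹)`, the inverse of `v`. -/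
noncomputable def vInv : A := sandwichRight k A 1 ((T.J⁻¹ : (A ⊗[k] A)ˣ) : A ⊗[k] A)

/-- `x ⊗ y ⊗ z ↦ S(x) y S(z)` -/
noncomputable def triple₁ : A ⊗[k] (A ⊗[k] A) →ₗ[k] A :=
  LinearMap.mul' k A ∘ₗ TensorProduct.map (HopfAlgebra.antipode k (A := A))
    (sandwichRight k A 1)

/-- `x ⊗ y ⊗ z ↦ x S(y) z` -/
noncomputable def triple₂ : A ⊗[k] (A ⊗[k] A) →ₗ[k] A :=
  LinearMap.mul' k A ∘ₗ TensorProduct.map LinearMap.id (sandwichLeft k A 1)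

theorem triple₁_tmul (x y z : A) : triple₁ (k := k) (x ⊗ₜ (y ⊗ₜ z)) =
    HopfAlgebra.antipode k x * y * HopfAlgebra.antipode k z := by
  simp [triple₁, sandwichRight_tmul, mul_assoc]

theorem triple₂_tmul (x y z : A) : triple₂ (k := k) (x ⊗ₜ (y ⊗ₜ z)) =
    x * HopfAlgebra.antipode k y * z := by
  simp [triple₂, sandwichLeft_tmul, mul_assoc]

theorem triple₁_eq (b c : A) (P Q : A ⊗[k] A) :
    triple₁ (Algebra.TensorProduct.assoc k k k A A A (P ⊗ₜ b) * (c ⊗ₜ Q)) =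
      HopfAlgebra.antipode k c * sandwichLeft k A 1 P * sandwichRight k A 1 Q
        * HopfAlgebra.antipode k b := by
  induction P using TensorProduct.induction_on with
  | zero => simp
  | add X₁ X₂ h₁ h₂ => simp [h₁, h₂, add_mul, mul_add, TensorProduct.add_tmul]
  | tmul x y =>
    induction Q using TensorProduct.induction_on with
    | zero => simp
    | add X₁ X₂ h₁ h₂ => simp only [h₁, h₂, add_mul, mul_add, TensorProduct.tmul_add, map_add]
    | tmul z w =>
      simp [triple₁_tmul, sandwichLeft_tmul, sandwichRight_tmul,
        HopfAlgebra.antipode_mul_antidistrib, mul_assoc]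

theorem triple₂_eq (b c : A) (P Q : A ⊗[k] A) :
    triple₂ ((c ⊗ₜ Q) * Algebra.TensorProduct.assoc k k k A A A (P ⊗ₜ b)) =
      c * sandwichRight k A 1 P * sandwichLeft k A 1 Q * b := by
  induction P using TensorProduct.induction_on with
  | zero => simp
  | add X₁ X₂ h₁ h₂ => simp [h₁, h₂, add_mul, mul_add, TensorProduct.add_tmul]
  | tmul x y =>
    induction Q using TensorProduct.induction_on with
    | zero => simp
    | add X₁ X₂ h₁ h₂ => simp only [h₁, h₂, add_mul, mul_add, TensorProduct.tmul_add, map_add]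
    | tmul z w =>
      simp [triple₂_tmul, sandwichLeft_tmul, sandwichRight_tmul,
        HopfAlgebra.antipode_mul_antidistrib, mul_assoc]

/-- `(ε ⊗ id)` followed by `k ⊗ A ≅ A` -/
noncomputable def epsLeft : A ⊗[k] A →ₐ[k] A :=
  (Algebra.TensorProduct.lid k A).toAlgHom.comp
    (Algebra.TensorProduct.map (Bialgebra.counitAlgHom k A) (AlgHom.id k A))

/-- `(id ⊗ ε)` followed by `A ⊗ k ≅ A` -/
noncomputable def epsRight : A ⊗[k] A →ₐ[k] A :=
  (Algebra.TensorProduct.rid k k A).toAlgHom.comp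
    (Algebra.TensorProduct.map (AlgHom.id k A) (Bialgebra.counitAlgHom k A))

theorem epsLeft_J : epsLeft (k := k) (T.J : A ⊗[k] A) = 1 := by
  simp [epsLeft, T.counit_left]

theorem epsRight_J : epsRight (k := k) (T.J : A ⊗[k] A) = 1 := by
  simp [epsRight, T.counit_right]

theorem map_inv_eq_one {B : Type*} [Ring B] [Algebra k B] (f : A ⊗[k] A →ₐ[k] B)
    (h : f (T.J : A ⊗[k] A) = 1) : f ((T.J⁻¹ : (A ⊗[k] A)ˣ) : A ⊗[k] A) = 1 := by
  have := congrArg f T.J.mul_inv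
  rwa [map_mul, h, one_mul, map_one] at this

/-- `Δ ⊗ id`, with values in `A ⊗ (A ⊗ A)` -/
noncomputable def comulLeft : A ⊗[k] A →ₐ[k] A ⊗[k] (A ⊗[k] A) :=
  (Algebra.TensorProduct.assoc k k k A A A).toAlgHom.comp
    (Algebra.TensorProduct.map (Bialgebra.comulAlgHom k A) (AlgHom.id k A))

/-- `id ⊗ Δ` -/
noncomputable def comulRight : A ⊗[k] A →ₐ[k] A ⊗[k] (A ⊗[k] A) :=
  Algebra.TensorProduct.map (AlgHom.id k A) (Bialgebra.comulAlgHom k A)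

/-- `X ↦ X ⊗ 1`, with values in `A ⊗ (A ⊗ A)` -/
noncomputable def inclLeft : A ⊗[k] A →ₐ[k] A ⊗[k] (A ⊗[k] A) :=
  (Algebra.TensorProduct.assoc k k k A A A).toAlgHom.comp
    Algebra.TensorProduct.includeLeft

/-- `X ↦ 1 ⊗ X` -/
noncomputable def inclRight : A ⊗[k] A →ₐ[k] A ⊗[k] (A ⊗[k] A) :=
  Algebra.TensorProduct.includeRight

theorem cocycle' : comulLeft (T.J : A ⊗[k] A) * inclLeft (T.J : A ⊗[k] A) =
    comulRight (T.J : A ⊗[k] A) * inclRight (T.J : A ⊗[k] A) := by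
  simpa [comulLeft, inclLeft, comulRight, inclRight] using T.cocycle

theorem epsLeft_tmul (a b : A) :
    epsLeft (k := k) (a ⊗ₜ[k] b) = Coalgebra.counit (R := k) a • b := rfl

theorem epsRight_tmul (a b : A) :
    epsRight (k := k) (a ⊗ₜ[k] b) = Coalgebra.counit (R := k) b • a := rfl

theorem comulLeft_tmul (a b : A) : comulLeft (k := k) (a ⊗ₜ[k] b) =
    Algebra.TensorProduct.assoc k k k A A A (Coalgebra.comul (R := k) a ⊗ₜ[k] b) := rfl

theorem comulRight_tmul (a b : A) : comulRight (k := k) (a ⊗ₜ[k] b) =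
    a ⊗ₜ[k] Coalgebra.comul (R := k) b := rfl

theorem inclLeft_apply (X : A ⊗[k] A) : inclLeft (k := k) X =
    Algebra.TensorProduct.assoc k k k A A A (X ⊗ₜ[k] 1) := rfl

theorem triple₁_comul (X Y : A ⊗[k] A) :
    triple₁ (comulLeft (k := k) X * comulRight Y) =
      HopfAlgebra.antipode k (epsRight Y) * HopfAlgebra.antipode k (epsLeft X) := by
  induction X using TensorProduct.induction_on with
  | zero => simp
  | add X₁ X₂ h₁ h₂ => simp only [map_add, h₁, h₂, add_mul, mul_add]
  | tmul x y =>
    induction Y using TensorProduct.induction_on with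
    | zero => simp
    | add X₁ X₂ h₁ h₂ => simp only [map_add, h₁, h₂, add_mul, mul_add]
    | tmul z w =>
      have := triple₁_eq y z (Coalgebra.comul (R := k) x) (Coalgebra.comul (R := k) w)
      simp only [sandwichLeft_comul, sandwichRight_comul] at this
      rw [comulLeft_tmul, comulRight_tmul, epsLeft_tmul, epsRight_tmul, this]
      simp [Algebra.algebraMap_eq_smul_one, smul_smul, mul_comm]

theorem triple₂_comul (X Y : A ⊗[k] A) :
    triple₂ (comulRight (k := k) Y * comulLeft X) = epsRight Y * epsLeft X := by
  induction X using TensorProduct.induction_on with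
  | zero => simp
  | add X₁ X₂ h₁ h₂ => simp only [map_add, h₁, h₂, mul_add]
  | tmul x y =>
    induction Y using TensorProduct.induction_on with
    | zero => simp
    | add X₁ X₂ h₁ h₂ => simp only [map_add, h₁, h₂, add_mul]
    | tmul z w =>
      have := triple₂_eq y z (Coalgebra.comul (R := k) x) (Coalgebra.comul (R := k) w)
      simp only [sandwichLeft_comul, sandwichRight_comul] at this
      rw [comulLeft_tmul, comulRight_tmul, epsLeft_tmul, epsRight_tmul, this]
      simp [Algebra.algebraMap_eq_smul_one, smul_smul, mul_comm]

theorem v_mul_vInv : T.v * T.vInv = 1 := by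
  have h1 : inclLeft (T.J : A ⊗[k] A) * inclRight ((T.J⁻¹ : (A ⊗[k] A)ˣ) : A ⊗[k] A) =
      comulLeft ((T.J⁻¹ : (A ⊗[k] A)ˣ) : A ⊗[k] A) * comulRight (T.J : A ⊗[k] A) := by
    have e1 : comulLeft ((T.J⁻¹ : (A ⊗[k] A)ˣ) : A ⊗[k] A) * comulLeft (T.J : A ⊗[k] A) = 1 := by
      rw [← map_mul, Units.inv_mul, map_one]
    have e2 : inclRight (T.J : A ⊗[k] A) * inclRight ((T.J⁻¹ : (A ⊗[k] A)ˣ) : A ⊗[k] A) = 1 := by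
      rw [← map_mul, Units.mul_inv, map_one]
    calc _ = (comulLeft ((T.J⁻¹ : (A ⊗[k] A)ˣ) : A ⊗[k] A) * comulLeft (T.J : A ⊗[k] A)) *
          (inclLeft (T.J : A ⊗[k] A) * inclRight ((T.J⁻¹ : (A ⊗[k] A)ˣ) : A ⊗[k] A)) := by
          rw [e1, one_mul]
      _ = comulLeft ((T.J⁻¹ : (A ⊗[k] A)ˣ) : A ⊗[k] A) * (comulLeft (T.J : A ⊗[k] A) *
          inclLeft (T.J : A ⊗[k] A)) * inclRight ((T.J⁻¹ : (A ⊗[k] A)ˣ) : A ⊗[k] A) := by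
          simp only [mul_assoc]
      _ = _ := by
          rw [T.cocycle', ← mul_assoc, mul_assoc _ (inclRight _), e2, mul_one]
  have h2 := triple₁_comul ((T.J⁻¹ : (A ⊗[k] A)ˣ) : A ⊗[k] A) (T.J : A ⊗[k] A)
  rw [← h1, T.epsRight_J, T.map_inv_eq_one _ T.epsLeft_J] at h2
  have h3 := triple₁_eq (1 : A) 1 (T.J : A ⊗[k] A) ((T.J⁻¹ : (A ⊗[k] A)ˣ) : A ⊗[k] A)
  simp only [HopfAlgebra.antipode_one, one_mul, mul_one] at h2 h3
  exact h3.symm.trans h2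

theorem vInv_mul_v : T.vInv * T.v = 1 := by
  have h1 : inclRight (T.J : A ⊗[k] A) * inclLeft ((T.J⁻¹ : (A ⊗[k] A)ˣ) : A ⊗[k] A) =
      comulRight ((T.J⁻¹ : (A ⊗[k] A)ˣ) : A ⊗[k] A) * comulLeft (T.J : A ⊗[k] A) := by
    have e1 : comulRight ((T.J⁻¹ : (A ⊗[k] A)ˣ) : A ⊗[k] A) * comulRight (T.J : A ⊗[k] A) = 1 := by
      rw [← map_mul, Units.inv_mul, map_one]
    have e2 : inclLeft (T.J : A ⊗[k] A) * inclLeft ((T.J⁻¹ : (A ⊗[k] A)ˣ) : A ⊗[k] A) = 1 := by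
      rw [← map_mul, Units.mul_inv, map_one]
    calc _ = (comulRight ((T.J⁻¹ : (A ⊗[k] A)ˣ) : A ⊗[k] A) * comulRight (T.J : A ⊗[k] A)) *
          (inclRight (T.J : A ⊗[k] A) * inclLeft ((T.J⁻¹ : (A ⊗[k] A)ˣ) : A ⊗[k] A)) := by
          rw [e1, one_mul]
      _ = comulRight ((T.J⁻¹ : (A ⊗[k] A)ˣ) : A ⊗[k] A) * (comulRight (T.J : A ⊗[k] A) *
          inclRight (T.J : A ⊗[k] A)) * inclLeft ((T.J⁻¹ : (A ⊗[k] A)ˣ) : A ⊗[k] A) := by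
          simp only [mul_assoc]
      _ = _ := by
          rw [← T.cocycle', ← mul_assoc, mul_assoc _ (inclLeft _), e2, mul_one]
  have h2 := triple₂_comul (T.J : A ⊗[k] A) ((T.J⁻¹ : (A ⊗[k] A)ˣ) : A ⊗[k] A)
  rw [← h1, T.epsLeft_J, T.map_inv_eq_one _ T.epsRight_J] at h2
  have h3 := triple₂_eq (1 : A) 1 ((T.J⁻¹ : (A ⊗[k] A)ˣ) : A ⊗[k] A) (T.J : A ⊗[k] A)
  simp only [one_mul, mul_one] at h2 h3
  exact h3.symm.trans h2

/-- Conjugation `X ↦ J⁻¹ X J` on `A ⊗ A`. -/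
noncomputable def conj : A ⊗[k] A →ₐ[k] A ⊗[k] A :=
  AlgHom.ofLinearMap
    (LinearMap.mulLeft k ((T.J⁻¹ : (A ⊗[k] A)ˣ) : A ⊗[k] A) ∘ₗ
      LinearMap.mulRight k (T.J : A ⊗[k] A))
    (by simp) (fun x y => by simp [mul_assoc])

/-- The twisted comultiplication `Δ^J(h) = J⁻¹ Δ(h) J`. -/
noncomputable def comul : A →ₐ[k] A ⊗[k] A := T.conj.comp (Bialgebra.comulAlgHom k A)

/-- The twisted antipode `S^J(h) = v⁻¹ S(h) v`. -/
noncomputable def antipode : A →ₗ[k] A :=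
  LinearMap.mulLeft k T.vInv ∘ₗ LinearMap.mulRight k T.v ∘ₗ HopfAlgebra.antipode k (A := A)

theorem comul_apply (h : A) : T.comul h = ((T.J⁻¹ : (A ⊗[k] A)ˣ) : A ⊗[k] A) *
    Coalgebra.comul (R := k) h * (T.J : A ⊗[k] A) := by
  simp [comul, conj, mul_assoc]

theorem antipode_apply (h : A) :
    T.antipode h = T.vInv * HopfAlgebra.antipode k h * T.v := by
  simp [antipode, mul_assoc]

theorem map_comul_left (X : A ⊗[k] A) :
    Algebra.TensorProduct.assoc k k k A A A
      (Algebra.TensorProduct.map T.comul (AlgHom.id k A) X) =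
    inclLeft ((T.J⁻¹ : (A ⊗[k] A)ˣ) : A ⊗[k] A) * comulLeft X * inclLeft (T.J : A ⊗[k] A) := by
  induction X using TensorProduct.induction_on with
  | zero => simp
  | add X₁ X₂ h₁ h₂ => simp only [map_add, h₁, h₂, add_mul, mul_add]
  | tmul x y =>
    rw [inclLeft_apply, inclLeft_apply, comulLeft_tmul, ← map_mul, ← map_mul,
      Algebra.TensorProduct.map_tmul, comul_apply]
    simp only [Algebra.TensorProduct.tmul_mul_tmul, AlgHom.id_apply, one_mul, mul_one]

theorem map_comul_right (X : A ⊗[k] A) :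
    Algebra.TensorProduct.map (AlgHom.id k A) T.comul X =
    inclRight ((T.J⁻¹ : (A ⊗[k] A)ˣ) : A ⊗[k] A) * comulRight X * inclRight (T.J : A ⊗[k] A) := by
  induction X using TensorProduct.induction_on with
  | zero => simp
  | add X₁ X₂ h₁ h₂ => simp only [map_add, h₁, h₂, add_mul, mul_add]
  | tmul x y =>
    simp only [inclRight, comulRight, Algebra.TensorProduct.map_tmul, comul_apply,
      Algebra.TensorProduct.includeRight_apply, Algebra.TensorProduct.tmul_mul_tmul,
      AlgHom.id_apply, one_mul, mul_one, Bialgebra.comulAlgHom_apply]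

theorem coassoc_aux (h : A) : comulLeft (Coalgebra.comul (R := k) h) =
    comulRight (Coalgebra.comul (R := k) h) := by
  have := Coalgebra.coassoc_apply (R := k) h
  exact this

theorem comul_coassoc (h : A) :
    Algebra.TensorProduct.assoc k k k A A A
      (Algebra.TensorProduct.map T.comul (AlgHom.id k A) (T.comul h)) =
    Algebra.TensorProduct.map (AlgHom.id k A) T.comul (T.comul h) := by
  rw [map_comul_left, map_comul_right, comul_apply]
  have hc := T.cocycle'
  have hi : inclLeft ((T.J⁻¹ : (A ⊗[k] A)ˣ) : A ⊗[k] A) *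
      comulLeft ((T.J⁻¹ : (A ⊗[k] A)ˣ) : A ⊗[k] A) =
      inclRight ((T.J⁻¹ : (A ⊗[k] A)ˣ) : A ⊗[k] A) *
      comulRight ((T.J⁻¹ : (A ⊗[k] A)ˣ) : A ⊗[k] A) := by
    refine left_inv_eq_right_inv (a := comulLeft (T.J : A ⊗[k] A) * inclLeft (T.J : A ⊗[k] A))
      ?_ ?_
    · rw [mul_assoc, ← mul_assoc (comulLeft _) (comulLeft _), ← map_mul, Units.inv_mul, map_one,
        one_mul, ← map_mul, Units.inv_mul, map_one]
    · rw [hc, mul_assoc, ← mul_assoc (inclRight _) (inclRight _), ← map_mul, Units.mul_inv,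
        map_one, one_mul, ← map_mul, Units.mul_inv, map_one]
  simp only [map_mul, ← mul_assoc]
  rw [hi, mul_assoc, hc, coassoc_aux]
  simp only [mul_assoc]

theorem counit_left_aux (h : A) :
    Algebra.TensorProduct.map (Bialgebra.counitAlgHom k A) (AlgHom.id k A) (T.comul h) =
      1 ⊗ₜ h := by
  rw [comul_apply, map_mul, map_mul, T.counit_left, T.map_inv_eq_one _ T.counit_left, one_mul,
    mul_one]
  exact Coalgebra.rTensor_counit_comul (R := k) h

theorem counit_right_aux (h : A) :
    Algebra.TensorProduct.map (AlgHom.id k A) (Bialgebra.counitAlgHom k A) (T.comul h) =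
      h ⊗ₜ 1 := by
  rw [comul_apply, map_mul, map_mul, T.counit_right, T.map_inv_eq_one _ T.counit_right, one_mul,
    mul_one]
  exact Coalgebra.lTensor_counit_comul (R := k) h

theorem antipode_left_aux (h : A) :
    LinearMap.mul' k A (T.antipode.rTensor A (T.comul h)) =
      algebraMap k A (Coalgebra.counit h) := by
  have key : ∀ X : A ⊗[k] A, LinearMap.mul' k A (T.antipode.rTensor A X) =
      T.vInv * sandwichLeft k A T.v X := by
    intro X
    induction X using TensorProduct.induction_on with
    | zero => simp
    | add X₁ X₂ h₁ h₂ => simp [h₁, h₂, mul_add]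
    | tmul x y => simp [sandwichLeft_tmul, antipode_apply, mul_assoc]
  have h1 : sandwichLeft k A T.v ((T.J⁻¹ : (A ⊗[k] A)ˣ) : A ⊗[k] A) = 1 := by
    rw [v, ← sandwichLeft_mul, Units.mul_inv, sandwichLeft_one]
  rw [key, comul_apply, sandwichLeft_mul, sandwichLeft_mul, h1, sandwichLeft_comul,
    sandwichLeft_algebraMap, ← v, mul_smul_comm, vInv_mul_v, Algebra.algebraMap_eq_smul_one]

theorem antipode_right_aux (h : A) :
    LinearMap.mul' k A (T.antipode.lTensor A (T.comul h)) =
      algebraMap k A (Coalgebra.counit h) := by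
  have key : ∀ X : A ⊗[k] A, LinearMap.mul' k A (T.antipode.lTensor A X) =
      sandwichRight k A T.vInv X * T.v := by
    intro X
    induction X using TensorProduct.induction_on with
    | zero => simp
    | add X₁ X₂ h₁ h₂ => simp [h₁, h₂, add_mul]
    | tmul x y => simp [sandwichRight_tmul, antipode_apply, mul_assoc]
  have h1 : sandwichRight k A T.vInv (T.J : A ⊗[k] A) = 1 := by
    rw [vInv, ← sandwichRight_mul, Units.mul_inv, sandwichRight_one]
  rw [key, comul_apply, sandwichRight_mul, sandwichRight_mul, h1, sandwichRight_comul,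
    sandwichRight_algebraMap, ← vInv, smul_mul_assoc, vInv_mul_v, Algebra.algebraMap_eq_smul_one]

/-- The twisted bialgebra structure on the algebra `A`: comultiplication `Δ^J`, counit `ε`. -/
noncomputable abbrev bialgebra : Bialgebra k A :=
  Bialgebra.ofAlgHom T.comul (Bialgebra.counitAlgHom k A)
    (AlgHom.ext T.comul_coassoc) (AlgHom.ext T.counit_left_aux) (AlgHom.ext T.counit_right_aux)

/-- The twisted Hopf algebra structure on the algebra `A`: comultiplication `Δ^J`, counit `ε`,
antipode `S^J`. -/
noncomputable abbrev hopfAlgebra : HopfAlgebra k A :=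
  { T.bialgebra with
    antipode := T.antipode
    mul_antipode_rTensor_comul := LinearMap.ext T.antipode_left_aux
    mul_antipode_lTensor_comul := LinearMap.ext T.antipode_right_aux }

/-- The Hopf algebra `A^J`: the algebra `A` with comultiplication `Δ^J`. -/
def Twisted (_T : HopfTwist k A) : Type _ := A

noncomputable instance : Ring T.Twisted := inferInstanceAs (Ring A)

noncomputable instance : HopfAlgebra k T.Twisted := T.hopfAlgebra

end HopfTwist

section CocycleDefs

variable {Γ M : Type*} [Group Γ] [CommGroup M]

/-- `ω : Γ × Γ → M` is a normalized `2`-cocycle on `Γ` with values in the trivial module `M`. -/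
structure IsNormalizedTwoCocycle (ω : Γ → Γ → M) : Prop where
  cocycle : ∀ α β γ, ω (α * β) γ * ω α β = ω α (β * γ) * ω β γ
  one_left : ∀ α, ω 1 α = 1
  one_right : ∀ α, ω α 1 = 1

/-- `ω : Γ × Γ → M` is a `2`-coboundary on `Γ` with values in the trivial module `M`. -/
def IsTwoCoboundary (ω : Γ → Γ → M) : Prop :=
  ∃ f : Γ → M, ∀ α β, ω α β = f α * f β / f (α * β)

end CocycleDefs

section AbelianTwist

/-- The character group of a group `H`, with values in the units of `M`. -/
abbrev CharGroup (M H : Type*) [CommMonoid M] [Group H] : Type _ := H →* Mˣ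

open scoped Classical in
/-- Given a family `e` in a Hopf algebra indexed by a finite group `Γ`, consisting of orthogonal
idempotents with sum `1` and satisfying `Δ(e_α) = ∑ e_β ⊗ e_{β⁻¹α}` and `ε(e_α) = δ_{α,1}`, and a
normalized `2`-cocycle `ω` on `Γ`, the element `∑ ω(α, β) e_α ⊗ e_β` is a twist. -/
noncomputable def twistOfIdempotents {k A Γ : Type*} [Field k] [Ring A] [HopfAlgebra k A]
    [Group Γ] [Fintype Γ] (e : Γ → A)
    (he : ∀ α β, e α * e β = if α = β then e α else 0) (he1 : ∑ α, e α = 1)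
    (hΔ : ∀ α, Coalgebra.comul (R := k) (e α) = ∑ β, e β ⊗ₜ[k] e (β⁻¹ * α))
    (hε : ∀ α, Coalgebra.counit (R := k) (e α) = if α = 1 then 1 else 0)
    (ω : Γ → Γ → kˣ) (hω : IsNormalizedTwoCocycle ω) : HopfTwist k A where
  J :=
    have hmul : ∀ f g : Γ → Γ → k,
        (∑ α, ∑ β, f α β • (e α ⊗ₜ[k] e β)) * (∑ α, ∑ β, g α β • (e α ⊗ₜ[k] e β)) =
          ∑ α, ∑ β, (f α β * g α β) • (e α ⊗ₜ[k] e β) := by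
      intro f g
      simp only [Finset.sum_mul_sum, smul_mul_smul_comm, Algebra.TensorProduct.tmul_mul_tmul, he]
      refine Finset.sum_congr rfl fun α _ => ?_
      rw [Finset.sum_comm]
      refine Finset.sum_congr rfl fun β _ => ?_
      rw [Finset.sum_eq_single α (fun b _ hb => by simp [hb.symm]) (by simp),
        Finset.sum_eq_single β (fun b _ hb => by simp [hb.symm]) (by simp)]
      simp
    have hone : (∑ α, ∑ β, (1 : k) • (e α ⊗ₜ[k] e β)) = 1 := by
      simp only [one_smul, ← TensorProduct.tmul_sum, he1, ← TensorProduct.sum_tmul]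
      rfl
    { val := ∑ α, ∑ β, (ω α β : k) • (e α ⊗ₜ[k] e β)
      inv := ∑ α, ∑ β, ((ω α β)⁻¹ : k) • (e α ⊗ₜ[k] e β)
      val_inv := by rw [hmul]; simpa using hone
      inv_val := by rw [hmul]; simpa using hone }
  cocycle := by
    have hmul3 : ∀ f g : Γ → Γ → Γ → k,
        (∑ α, ∑ β, ∑ γ, f α β γ • (e α ⊗ₜ[k] (e β ⊗ₜ[k] e γ))) *
          (∑ α, ∑ β, ∑ γ, g α β γ • (e α ⊗ₜ[k] (e β ⊗ₜ[k] e γ))) =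
          ∑ α, ∑ β, ∑ γ, (f α β γ * g α β γ) • (e α ⊗ₜ[k] (e β ⊗ₜ[k] e γ)) := by
      intro f g
      have h1 : ∀ α β γ, (e α ⊗ₜ[k] (e β ⊗ₜ[k] e γ)) *
          (∑ α, ∑ β, ∑ γ, g α β γ • (e α ⊗ₜ[k] (e β ⊗ₜ[k] e γ))) =
          g α β γ • (e α ⊗ₜ[k] (e β ⊗ₜ[k] e γ)) := by
        intro α β γ
        simp only [Finset.mul_sum, mul_smul_comm, Algebra.TensorProduct.tmul_mul_tmul, he]
        rw [Finset.sum_eq_single α (fun b _ hb => by simp [hb.symm]) (by simp),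
          Finset.sum_eq_single β (fun b _ hb => by simp [hb.symm]) (by simp),
          Finset.sum_eq_single γ (fun b _ hb => by simp [hb.symm]) (by simp)]
        simp
      simp only [Finset.sum_mul, smul_mul_assoc, h1, smul_smul]
    have a1 : Algebra.TensorProduct.assoc k k k A A A (Algebra.TensorProduct.map
        (Bialgebra.comulAlgHom k A) (AlgHom.id k A)
          (∑ α, ∑ β, (ω α β : k) • (e α ⊗ₜ[k] e β))) =
        ∑ α, ∑ β, ∑ γ, (ω (α * β) γ : k) • (e α ⊗ₜ[k] (e β ⊗ₜ[k] e γ)) := by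
      simp only [map_sum, map_smul, Algebra.TensorProduct.map_tmul, Bialgebra.comulAlgHom_apply,
        hΔ, AlgHom.id_apply, TensorProduct.sum_tmul, Algebra.TensorProduct.assoc_tmul,
        Finset.smul_sum]
      rw [Finset.sum_comm' (t' := Finset.univ) (s' := fun _ => Finset.univ) (by simp)]
      rw [show (∑ y, ∑ x, ∑ i, (ω x y : k) • (e i ⊗ₜ[k] (e (i⁻¹ * x) ⊗ₜ[k] e y))) =
        ∑ y, ∑ i, ∑ x, (ω x y : k) • (e i ⊗ₜ[k] (e (i⁻¹ * x) ⊗ₜ[k] e y)) from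
        Finset.sum_congr rfl fun _ _ => Finset.sum_comm]
      rw [Finset.sum_comm]
      refine Finset.sum_congr rfl fun i _ => ?_
      rw [Finset.sum_comm]
      rw [← Equiv.sum_comp (Equiv.mulLeft i)]
      simp
    have a2 : Algebra.TensorProduct.map (AlgHom.id k A) (Bialgebra.comulAlgHom k A)
          (∑ α, ∑ β, (ω α β : k) • (e α ⊗ₜ[k] e β)) =
        ∑ α, ∑ β, ∑ γ, (ω α (β * γ) : k) • (e α ⊗ₜ[k] (e β ⊗ₜ[k] e γ)) := by
      simp only [map_sum, map_smul, Algebra.TensorProduct.map_tmul, Bialgebra.comulAlgHom_apply,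
        hΔ, AlgHom.id_apply, TensorProduct.tmul_sum, Finset.smul_sum]
      refine Finset.sum_congr rfl fun i _ => ?_
      rw [Finset.sum_comm]
      refine Finset.sum_congr rfl fun j _ => ?_
      rw [← Equiv.sum_comp (Equiv.mulLeft j)]
      simp
    have a3 : Algebra.TensorProduct.assoc k k k A A A
        ((∑ α, ∑ β, (ω α β : k) • (e α ⊗ₜ[k] e β)) ⊗ₜ[k] (1 : A)) =
        ∑ α, ∑ β, ∑ γ : Γ, (ω α β : k) • (e α ⊗ₜ[k] (e β ⊗ₜ[k] e γ)) := by
      simp only [TensorProduct.sum_tmul, map_sum, ← TensorProduct.smul_tmul', map_smul,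
        Algebra.TensorProduct.assoc_tmul]
      refine Finset.sum_congr rfl fun α _ => Finset.sum_congr rfl fun β _ => ?_
      rw [← he1, TensorProduct.tmul_sum, TensorProduct.tmul_sum, Finset.smul_sum]
    have a4 : (1 : A) ⊗ₜ[k] (∑ α, ∑ β, (ω α β : k) • (e α ⊗ₜ[k] e β)) =
        ∑ α : Γ, ∑ β, ∑ γ, (ω β γ : k) • (e α ⊗ₜ[k] (e β ⊗ₜ[k] e γ)) := by
      rw [← he1, TensorProduct.sum_tmul]
      simp only [TensorProduct.tmul_sum, TensorProduct.tmul_smul]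
    rw [map_mul]
    dsimp only
    rw [a1, a2, a3, a4, hmul3, hmul3]
    refine Finset.sum_congr rfl fun α _ => Finset.sum_congr rfl fun β _ =>
      Finset.sum_congr rfl fun γ _ => ?_
    rw [← Units.val_mul, ← Units.val_mul, hω.cocycle]
  counit_left := by
    simp only [map_sum, map_smul, Algebra.TensorProduct.map_tmul, Bialgebra.counitAlgHom_apply,
      hε, AlgHom.id_apply]
    rw [Finset.sum_eq_single 1 (fun b _ hb => by simp [hb]) (by simp)]
    simp only [hω.one_left, Units.val_one, one_smul, ← TensorProduct.tmul_sum, he1, if_true]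
    rfl
  counit_right := by
    simp only [map_sum, map_smul, Algebra.TensorProduct.map_tmul, Bialgebra.counitAlgHom_apply,
      hε, AlgHom.id_apply]
    rw [Finset.sum_comm, Finset.sum_eq_single 1 (fun b _ hb => by simp [hb]) (by simp)]
    simp only [hω.one_right, Units.val_one, one_smul, ← TensorProduct.sum_tmul, he1, if_true]
    rfl

variable (k : Type*) [Field k] {G : Type*} [Group G] [Finite G]

/-- The idempotent `e_χ = |H|⁻¹ ∑_{h ∈ H} χ(h⁻¹) h` of `kH ⊆ kG` attached to a character `χ` of
a subgroup `H` of `G`. -/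
noncomputable def charIdempotent (H : Subgroup G) (χ : CharGroup k H) : MonoidAlgebra k G :=
  letI := Fintype.ofFinite H
  (Nat.card H : k)⁻¹ • ∑ h : H, (χ h⁻¹ : k) • MonoidAlgebra.single (h : G) (1 : k)

theorem sum_hom_units_dual {H : Type*} [Group H] [Fintype H] (χ : CharGroup k H) [Decidable (χ = 1)] :
    ∑ h : H, (χ h : k) = if χ = 1 then (Nat.card H : k) else 0 := by
  split_ifs with h
  · subst h
    simp [Nat.card_eq_fintype_card]
  · refine sum_hom_units_eq_zero ((Units.coeHom k).comp χ) fun hx => h ?_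
    ext x
    simpa using DFunLike.congr_fun hx x

theorem sum_dual_eq [IsAlgClosed k] [CharZero k] {H : Type*} [Group H] [Finite H] [IsMulCommutative H]
    [Fintype (CharGroup k H)] [DecidableEq H] (h : H) :
    ∑ χ : CharGroup k H, (χ h : k) = if h = 1 then (Nat.card H : k) else 0 := by
  classical
  let _ : CommGroup H := { mul_comm := fun a b => IsMulCommutative.is_comm.comm a b }
  have hx := sum_hom_units_dual k (MonoidHom.eval h : CharGroup k H →* kˣ)
  have hc : Nat.card (CharGroup k H) = Nat.card H :=
    CommGroup.card_monoidHom_of_hasEnoughRootsOfUnity H k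
  rw [hc] at hx
  refine hx.trans (if_congr ⟨fun hh => ?_, fun hh => ?_⟩ rfl rfl)
  · by_contra hne
    obtain ⟨φ, hφ⟩ := CommGroup.exists_apply_ne_one_of_hasEnoughRootsOfUnity H k hne
    exact hφ (DFunLike.congr_fun hh φ)
  · subst hh
    ext χ
    simp

section idempotents

variable [CharZero k] (H : Subgroup G)

open scoped Classical in
theorem charIdempotent_mul (α β : CharGroup k H) :
    charIdempotent k H α * charIdempotent k H β =
      if α = β then charIdempotent k H α else 0 := by
  let _ := Fintype.ofFinite H
  have hcard : (Nat.card H : k) ≠ 0 := Nat.cast_ne_zero.2 Nat.card_pos.ne'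
  have key : ∀ h : H, (MonoidAlgebra.single (h : G) (1 : k)) * charIdempotent k H β =
      (β h : k) • charIdempotent k H β := by
    intro h
    simp only [charIdempotent, mul_smul_comm, Finset.mul_sum, MonoidAlgebra.single_mul_single,
      one_mul]
    rw [smul_comm]
    congr 1
    rw [Finset.smul_sum, ← Equiv.sum_comp (Equiv.mulLeft h⁻¹)]
    refine Finset.sum_congr rfl fun x _ => ?_
    simp [mul_comm]
  conv_lhs => rw [charIdempotent]
  simp only [smul_mul_assoc, Finset.sum_mul, key, smul_smul]
  rw [← Finset.sum_smul, smul_smul]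
  have h2 := sum_hom_units_dual k (α⁻¹ * β)
  have h3 : ∀ x : H, (α x⁻¹ : k) * (β x : k) = ((α⁻¹ * β) x : kˣ) := by intro x; simp
  simp only [h3, h2]
  by_cases hab : α = β
  · subst hab
    rw [if_pos (inv_mul_cancel α), if_pos rfl, inv_mul_cancel₀ hcard, one_smul]
  · have : α⁻¹ * β ≠ 1 := fun h => hab (inv_mul_eq_one.1 h)
    simp [this, hab]

theorem single_eq_sum_charIdempotent [IsAlgClosed k] [IsMulCommutative H] [Fintype (CharGroup k H)] (h : H) :
    MonoidAlgebra.single (h : G) (1 : k) = ∑ χ : CharGroup k H, (χ h : k) • charIdempotent k H χ := by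
  classical
  let _ := Fintype.ofFinite H
  have hcard : (Nat.card H : k) ≠ 0 := Nat.cast_ne_zero.2 Nat.card_pos.ne'
  simp only [charIdempotent, smul_comm _ (Nat.card H : k)⁻¹, ← Finset.smul_sum]
  simp only [Finset.smul_sum, smul_smul]
  rw [Finset.sum_comm]
  have h3 : ∀ (x : H) (χ : CharGroup k H), (Nat.card H : k)⁻¹ * ((χ h : k) * (χ x⁻¹ : k)) =
      (Nat.card H : k)⁻¹ * (χ (h * x⁻¹) : k) := by intro x χ; simp
  simp only [h3, ← Finset.sum_smul, ← Finset.mul_sum, sum_dual_eq]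
  rw [Finset.sum_eq_single h (fun b _ hb => by simp [mul_inv_eq_one, hb.symm]) (by simp)]
  simp

theorem sum_charIdempotent [IsAlgClosed k] [IsMulCommutative H] [Fintype (CharGroup k H)] :
    ∑ χ : CharGroup k H, charIdempotent k H χ = 1 := by
  have := single_eq_sum_charIdempotent k H 1
  simpa [MonoidAlgebra.one_def] using this.symm

open scoped Classical in
theorem counit_charIdempotent (χ : CharGroup k H) :
    Coalgebra.counit (R := k) (charIdempotent k H χ) = if χ = 1 then 1 else 0 := by
  let _ := Fintype.ofFinite H
  have hcard : (Nat.card H : k) ≠ 0 := Nat.cast_ne_zero.2 Nat.card_pos.ne'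
  have h2 := sum_hom_units_dual k χ⁻¹
  have h3 : ∀ x : H, (χ x⁻¹ : k) = ((χ⁻¹) x : kˣ) := by intro x; simp
  simp only [charIdempotent, map_smul, map_sum, MonoidAlgebra.counit_single, h3,
    CommSemiring.counit_apply, smul_eq_mul, mul_one, h2]
  by_cases h : χ = 1
  · rw [if_pos (inv_eq_one.2 h), if_pos h, inv_mul_cancel₀ hcard]
  · rw [if_neg (fun h' => h (inv_eq_one.1 h')), if_neg h, mul_zero]

theorem comul_charIdempotent [IsAlgClosed k] [IsMulCommutative H] [Fintype (CharGroup k H)] (χ : CharGroup k H) :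
    Coalgebra.comul (R := k) (charIdempotent k H χ) =
      ∑ β : CharGroup k H, charIdempotent k H β ⊗ₜ[k] charIdempotent k H (β⁻¹ * χ) := by
  classical
  let _ := Fintype.ofFinite H
  have hcard : (Nat.card H : k) ≠ 0 := Nat.cast_ne_zero.2 Nat.card_pos.ne'
  have h1 : ∀ h : H, Coalgebra.comul (R := k) (MonoidAlgebra.single (h : G) (1 : k)) =
      ∑ β : CharGroup k H, ∑ γ : CharGroup k H, ((β h : k) * (γ h : k)) •
        (charIdempotent k H β ⊗ₜ[k] charIdempotent k H γ) := by
    intro h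
    have : Coalgebra.comul (R := k) (MonoidAlgebra.single (h : G) (1 : k)) =
        MonoidAlgebra.single (h : G) (1 : k) ⊗ₜ[k] MonoidAlgebra.single (h : G) (1 : k) := by
      simp
    rw [this, single_eq_sum_charIdempotent k H h]
    simp only [TensorProduct.sum_tmul, TensorProduct.tmul_sum, TensorProduct.smul_tmul_smul]
    rw [Finset.sum_comm]
  rw [charIdempotent]
  simp only [map_smul, map_sum, h1, Finset.smul_sum, smul_smul]
  rw [Finset.sum_comm]
  refine Finset.sum_congr rfl fun β _ => ?_
  rw [Finset.sum_comm]
  simp only [← Finset.sum_smul, mul_assoc, ← Finset.mul_sum]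
  have h3 : ∀ (γ : CharGroup k H), ∑ x : H, (χ x⁻¹ : k) * ((β x : k) * (γ x : k)) =
      if χ⁻¹ * β * γ = 1 then (Nat.card H : k) else 0 := by
    intro γ
    rw [← sum_hom_units_dual]
    exact Finset.sum_congr rfl fun x _ => by simp [mul_assoc]
  simp only [h3]
  rw [Finset.sum_eq_single (β⁻¹ * χ)]
  · have h4 : χ⁻¹ * β * (β⁻¹ * χ) = 1 := by group
    rw [if_pos h4, inv_mul_cancel₀ hcard, one_smul]
  · intro b _ hb
    have h4 : χ⁻¹ * β * b ≠ 1 := fun h => hb (by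
      have h5 := eq_inv_of_mul_eq_one_right h
      rw [h5]
      group)
    rw [if_neg h4, mul_zero, zero_smul]
  · simp

end idempotents

/-- The twist `J = ∑_{α, β} ω(α, β) e_α ⊗ e_β` in `kG` attached to an abelian subgroup `H` of a
finite group `G` and a normalized `2`-cocycle `ω` on the character group of `H`. -/
noncomputable def abelianTwist [IsAlgClosed k] [CharZero k] (H : Subgroup G) [IsMulCommutative H]
    (ω : (CharGroup k H) → (CharGroup k H) → kˣ) (hω : IsNormalizedTwoCocycle ω) :
    HopfTwist k (MonoidAlgebra k G) :=
  letI := Fintype.ofFinite (CharGroup k H)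
  twistOfIdempotents (charIdempotent k H) (charIdempotent_mul k H) (sum_charIdempotent k H)
    (comul_charIdempotent k H) (counit_charIdempotent k H) ω hω

end AbelianTwist

/-- The subgroup of `S_n` generated by the transpositions `(1 2)` and `(3 4)`; the letters
`1, …, n` are the elements `0, …, n - 1` of `Fin n`. -/
def twoTranspositions (n : ℕ) (hn : 4 ≤ n) : Subgroup (Equiv.Perm (Fin n)) :=
  Subgroup.closure
    {Equiv.swap ⟨0, by omega⟩ ⟨1, by omega⟩, Equiv.swap ⟨2, by omega⟩ ⟨3, by omega⟩}

instance (n : ℕ) (hn : 4 ≤ n) : IsMulCommutative (twoTranspositions n hn) := by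
  have h : Equiv.Perm.Disjoint
      (Equiv.swap (⟨0, by omega⟩ : Fin n) ⟨1, by omega⟩)
      (Equiv.swap (⟨2, by omega⟩ : Fin n) ⟨3, by omega⟩) := by
    intro x
    by_cases h0 : x.val = 0 ∨ x.val = 1
    · right
      apply Equiv.swap_apply_of_ne_of_ne <;> (intro h; subst h; simp at h0)
    · left
      apply Equiv.swap_apply_of_ne_of_ne <;> (intro h; subst h; simp at h0)
  refine Subgroup.isMulCommutative_closure ?_
  rintro x (rfl | rfl) y (rfl | rfl)
  · rfl
  · exact h.commute.eq
  · exact h.commute.eq.symm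
  · rfl

/-! Let `A = kS_n` and let `K` be a normal Hopf subalgebra of `A^J`. The plan is to read `K` off its
normalized integral `e`. Since `S(v) = v`, the antipode of `A^J` is an involution, and a trace
computation in characteristic zero produces `e` (`exists_left_integral`, `exists_integral`).
Normality of `K` makes `e` central (`integral_commute`).

Twisting does not change the product, so `e` is central in `A` and `J` cancels from `Δ^J(e)(1 ⊗ e) =
e ⊗ e`, leaving `Δ(e)(1 ⊗ e) = e ⊗ e` in the untwisted group algebra. Comparing coefficients, the
support of `e` is its left stabilizer `N`, a normal subgroup of `S_n`. As `n ≥ 5`, `N` is trivial,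
`A_n` or `S_n`. If `N` is trivial then `e = 1` and `K = k1`. If `N = S_n` then `e` is an integral of
all of `A^J`, and a Hopf subalgebra containing such an integral is everything
(`eq_top_of_integral_mem`).

It remains to exclude `N = A_n`. Then the sign character `σ` satisfies `σ(e) = 1`, so every `x ∈ K`
is fixed by `(id ⊗ σ)Δ^J` and by `(σ ⊗ id)Δ^J`. Because `Δ` is cocommutative, such an `x` commutes
with `w = (id ⊗ σ)(J)⁻¹ (σ ⊗ id)(J)`, an element of `kH`. Applied to the first legs of `Δ^J(e)`,
this shows that every element of `A_n` commutes with `w`. A 3-cycle in `A_n` conjugates all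
nontrivial elements of `H` out of `H`, so `w` is a scalar, which says that `ω(s, α) = ω(α, s)` for
`s = σ|_H` (`cocycle_symm_of_invariant`). On a Klein four-group, symmetry at one nontrivial element
already makes `ω` a coboundary (`isTwoCoboundary_of_symm`), a contradiction. -/

/-! ### Integrals, slice maps and Hopf subalgebras. -/

section HopfIntegrals

open Coalgebra HopfAlgebra

variable {k B : Type*} [Field k] [Ring B] [HopfAlgebra k B]

/-- The Sweedler identity `∑ S(x₁) x₂ ⊗ x₃ = 1 ⊗ x`. -/
theorem HopfAlgebra.sum_antipode_tmul_one_mul_comul {ι : Type*} {s : Finset ι} {f g : ι → B} {x : B}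
    (h : comul (R := k) x = ∑ i ∈ s, f i ⊗ₜ[k] g i) :
    ∑ i ∈ s, (antipode k (f i) ⊗ₜ[k] (1 : B)) * comul (R := k) (g i) = 1 ⊗ₜ[k] x := by
  -- `Φ` is `a ⊗ b ⊗ c ↦ S(a) b ⊗ c`; after reassociating, the antipode axiom collapses the first
  -- two legs.
  let Φ : B ⊗[k] (B ⊗[k] B) →ₗ[k] B ⊗[k] B :=
    LinearMap.rTensor B (LinearMap.mul' k B ∘ₗ (antipode k).rTensor B) ∘ₗ
      (TensorProduct.assoc k B B B).symm.toLinearMap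
  have hΦ : ∀ (a : B) (X : B ⊗[k] B), Φ (a ⊗ₜ X) = (antipode k a ⊗ₜ[k] (1 : B)) * X := by
    intro a X
    induction X using TensorProduct.induction_on with
    | zero => simp
    | add X₁ X₂ h₁ h₂ => simp only [TensorProduct.tmul_add, map_add, h₁, h₂, mul_add]
    | tmul b c => simp [Φ]
  have h1 : Φ ((comul (R := k)).lTensor B (comul (R := k) x)) = 1 ⊗ₜ[k] x := by
    have h2 : ∀ X : B ⊗[k] B, LinearMap.rTensor B (LinearMap.mul' k B ∘ₗ (antipode k).rTensor B)
        ((comul (R := k)).rTensor B X) =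
        (Algebra.linearMap k B).rTensor B ((counit (R := k)).rTensor B X) := by
      intro X
      rw [← LinearMap.rTensor_comp_apply, ← LinearMap.rTensor_comp_apply, LinearMap.comp_assoc,
        mul_antipode_rTensor_comul]
    simp only [Φ, LinearMap.comp_apply, LinearEquiv.coe_coe, coassoc_symm_apply, h2,
      rTensor_counit_comul]
    simp
  rw [← h1, h]
  simp [hΦ]

/-- `(1 ⊗ a) Δ(Λ) = (S(a) ⊗ 1) Δ(Λ)` for a left integral `Λ`. -/
theorem HopfAlgebra.one_tmul_mul_comul_integral {Λ : B}
    (hΛ : ∀ a, a * Λ = counit (R := k) a • Λ) (a : B) :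
    ((1 : B) ⊗ₜ[k] a) * comul (R := k) Λ = (antipode k a ⊗ₜ[k] (1 : B)) * comul (R := k) Λ := by
  obtain ⟨S, hS⟩ := TensorProduct.exists_finset (comul (R := k) a)
  rw [← sum_antipode_tmul_one_mul_comul hS, Finset.sum_mul]
  -- Write `a = ∑ ε(a₂) a₁` and absorb `ε(a₂)` into `Λ` as `a₂ Λ`; multiplicativity of `Δ` then
  -- leaves the Sweedler sum above.
  have h1 : ∑ i ∈ S, counit (R := k) i.2 • i.1 = a := by
    have := lTensor_counit_comul (R := k) a
    rw [hS] at this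
    simpa [← TensorProduct.tmul_smul] using congrArg (TensorProduct.rid k B) this
  conv_rhs => rw [← h1]
  simp only [map_sum, TensorProduct.sum_tmul, Finset.sum_mul, map_smul]
  refine Finset.sum_congr rfl fun i _ => ?_
  rw [mul_assoc, ← Bialgebra.comul_mul, hΛ, map_smul, mul_smul_comm, ← TensorProduct.smul_tmul',
    smul_mul_assoc]

/-- The slice map `X ↦ (f ⊗ id)(X)`. -/
noncomputable def TensorProduct.sliceLeft (f : Module.Dual k B) : B ⊗[k] B →ₗ[k] B :=
  (TensorProduct.lid k B).toLinearMap ∘ₗ f.rTensor B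

/-- The slice map `X ↦ (id ⊗ f)(X)`. -/
noncomputable def TensorProduct.sliceRight (f : Module.Dual k B) : B ⊗[k] B →ₗ[k] B :=
  (TensorProduct.rid k B).toLinearMap ∘ₗ f.lTensor B

@[simp]
theorem TensorProduct.sliceLeft_tmul (f : Module.Dual k B) (a b : B) :
    TensorProduct.sliceLeft f (a ⊗ₜ b) = f a • b := by
  simp [TensorProduct.sliceLeft]

@[simp]
theorem TensorProduct.sliceRight_tmul (f : Module.Dual k B) (a b : B) :
    TensorProduct.sliceRight f (a ⊗ₜ b) = f b • a := by
  simp [TensorProduct.sliceRight]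

namespace HopfSubalgebra

open TensorProduct

variable (K : HopfSubalgebra k B)

theorem exists_comul_eq_sum {x : B} (hx : x ∈ K.toSubalgebra) :
    ∃ s : Finset (K.toSubalgebra × K.toSubalgebra),
      comul (R := k) x = ∑ p ∈ s, (p.1 : B) ⊗ₜ[k] (p.2 : B) := by
  obtain ⟨z, hz⟩ := K.comul_mem x hx
  obtain ⟨s, rfl⟩ := TensorProduct.exists_finset z
  exact ⟨s, by simp [← hz]⟩

theorem sliceLeft_comul_mem {x : B} (hx : x ∈ K.toSubalgebra) (f : Module.Dual k B) :
    sliceLeft f (comul (R := k) x) ∈ K.toSubalgebra := by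
  obtain ⟨s, hs⟩ := K.exists_comul_eq_sum hx
  rw [hs]
  simp only [map_sum, sliceLeft_tmul]
  exact sum_mem fun p _ => Subalgebra.smul_mem _ p.2.2 _

theorem sliceRight_comul_mem {x : B} (hx : x ∈ K.toSubalgebra) (f : Module.Dual k B) :
    sliceRight f (comul (R := k) x) ∈ K.toSubalgebra := by
  obtain ⟨s, hs⟩ := K.exists_comul_eq_sum hx
  rw [hs]
  simp only [map_sum, sliceRight_tmul]
  exact sum_mem fun p _ => Subalgebra.smul_mem _ p.1.2 _

/-- A Hopf subalgebra containing a left integral `Λ` with `ε(Λ) = 1` of the whole Hopf algebra is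
the whole Hopf algebra. -/
theorem eq_top_of_integral_mem {Λ : B} (hΛ : ∀ a, a * Λ = counit (R := k) a • Λ)
    (hε : counit (R := k) Λ = 1) (hK : Λ ∈ K.toSubalgebra) : K.toSubalgebra = ⊤ := by
  rw [eq_top_iff]
  rintro a -
  let b := Module.Free.chooseBasis k B
  -- Left multiplication by `a` on a slice of `Δ(Λ)` only changes the slicing functional, from `f`
  -- to `f(S(a) ·)`. So the slices, which lie in `K`, are stable under multiplication by all of `B`.
  have key : ∀ (f : Module.Dual k B) (a : B),
      a * sliceLeft f (comul (R := k) Λ) ∈ K.toSubalgebra := by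
    intro f a
    have h1 : ∀ X : B ⊗[k] B, a * sliceLeft f X = sliceLeft f (((1 : B) ⊗ₜ[k] a) * X) := by
      intro X
      induction X using TensorProduct.induction_on with
      | zero => simp
      | add X₁ X₂ h₁ h₂ => simp only [map_add, h₁, h₂, mul_add]
      | tmul b c => simp
    have h2 : ∀ X : B ⊗[k] B, sliceLeft f ((antipode k a ⊗ₜ[k] (1 : B)) * X) =
        sliceLeft (f ∘ₗ LinearMap.mulLeft k (antipode k a)) X := by
      intro X
      induction X using TensorProduct.induction_on with
      | zero => simp
      | add X₁ X₂ h₁ h₂ => simp only [map_add, h₁, h₂, mul_add]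
      | tmul b c => simp
    rw [h1, one_tmul_mul_comul_integral hΛ, h2]
    exact K.sliceLeft_comul_mem hK _
  -- Since `∑ S(Λ₁) Λ₂ = ε(Λ) = 1`, every `a` equals `∑ a S(Λ₁) Λ₂`. Expanding the first leg in a
  -- basis turns this into a sum of terms covered by `key`.
  have h3 := mul_antipode_rTensor_comul_apply (R := k) Λ
  rw [hε, map_one] at h3
  have h4 : ∀ X : B ⊗[k] B, (∀ (f : Module.Dual k B) (a : B), a * sliceLeft f X ∈ K.toSubalgebra) →
      LinearMap.mul' k B ((LinearMap.mulLeft k a ∘ₗ antipode k).rTensor B X) ∈ K.toSubalgebra := by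
    intro X hX
    obtain ⟨c, rfl⟩ := TensorProduct.eq_repr_basis_left b X
    simp only [Finsupp.sum, map_sum, LinearMap.rTensor_tmul, LinearMap.mul'_apply]
    refine sum_mem fun i hi => ?_
    have := hX (b.coord i) ((LinearMap.mulLeft k a ∘ₗ antipode k) (b i))
    simp only [Finsupp.sum, map_sum, sliceLeft_tmul, Module.Basis.coord_apply, Module.Basis.repr_self,
      Finsupp.single_apply] at this
    simpa using this
  have h5 : a = LinearMap.mul' k B ((LinearMap.mulLeft k a ∘ₗ antipode k).rTensor B
      (comul (R := k) Λ)) := by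
    have h6 : ∀ X : B ⊗[k] B, LinearMap.mul' k B ((LinearMap.mulLeft k a ∘ₗ antipode k).rTensor B X)
        = a * LinearMap.mul' k B ((antipode k).rTensor B X) := by
      intro X
      induction X using TensorProduct.induction_on with
      | zero => simp
      | add X₁ X₂ h₁ h₂ => simp only [map_add, h₁, h₂, mul_add]
      | tmul b c => simp [mul_assoc]
    rw [h6, h3, mul_one]
  rw [h5]
  exact h4 _ key

end HopfSubalgebra

end HopfIntegrals

/-! ### Existence and centrality of integrals of Hopf subalgebras. -/

section HopfIntegrals

open Coalgebra HopfAlgebra TensorProduct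

variable {k B : Type*} [Field k] [Ring B] [HopfAlgebra k B]

theorem TensorProduct.apply_sliceLeft (f g : Module.Dual k B) (X : B ⊗[k] B) :
    f (sliceLeft g X) = g (sliceRight f X) := by
  induction X using TensorProduct.induction_on with
  | zero => simp
  | add X₁ X₂ h₁ h₂ => simp only [map_add, h₁, h₂]
  | tmul b c => simp [mul_comm]

theorem LinearMap.trace_eq_sum_coord {ι M : Type*} [Fintype ι] [AddCommGroup M] [Module k M]
    (b : Module.Basis ι k M) (φ : M →ₗ[k] M) :
    LinearMap.trace k M φ = ∑ i, b.coord i (φ (b i)) := by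
  classical
  rw [LinearMap.trace_eq_matrix_trace k b, Matrix.trace]
  simp [LinearMap.toMatrix_apply]

/-- Apply the antimultiplicative `S` to `∑ x₁ S(x₂) = ε(x)`; involutivity removes the double
antipode. -/
theorem HopfAlgebra.sum_mul_antipode_flip (hS : ∀ a : B, antipode k (antipode k a) = a)
    {ι : Type*} {s : Finset ι} {f g : ι → B} {x : B}
    (h : comul (R := k) x = ∑ i ∈ s, f i ⊗ₜ[k] g i) :
    ∑ i ∈ s, g i * antipode k (f i) = algebraMap k B (counit x) := by
  have h1 := mul_antipode_lTensor_comul_apply (R := k) x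
  rw [h] at h1
  simp only [map_sum, LinearMap.lTensor_tmul, LinearMap.mul'_apply] at h1
  have h2 := congrArg (antipode k) h1
  rw [map_sum, Algebra.algebraMap_eq_smul_one, map_smul, antipode_one] at h2
  simpa [antipode_mul_antidistrib, hS, Algebra.algebraMap_eq_smul_one] using h2

namespace HopfSubalgebra

variable (K : HopfSubalgebra k B)

/-- In characteristic zero, a Hopf subalgebra of a finite-dimensional Hopf algebra with involutive
antipode has a normalized left integral. -/
theorem exists_left_integral [CharZero k] [FiniteDimensional k B]
    (hS : ∀ a : B, antipode k (antipode k a) = a) :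
    ∃ e ∈ K.toSubalgebra, counit (R := k) e = 1 ∧
      ∀ x ∈ K.toSubalgebra, x * e = counit (R := k) x • e := by
  let V : Submodule k B := Subalgebra.toSubmodule K.toSubalgebra
  obtain ⟨p, hp⟩ := V.subtype.exists_leftInverse_of_injective V.ker_subtype
  -- A linear projection onto `K`, so that traces over `K` can be computed as traces over `B`.
  let P : B →ₗ[k] B := V.subtype ∘ₗ p
  have hPK : ∀ a, P a ∈ K.toSubalgebra := fun a => (p a).2
  have hPx : ∀ a ∈ K.toSubalgebra, P a = a := fun a ha =>
    congrArg Subtype.val (LinearMap.congr_fun hp (⟨a, ha⟩ : V))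
  let b := Module.finBasis k B
  let M : Module.Dual k B → B →ₗ[k] B := fun f => sliceRight f ∘ₗ comul
  have hMK : ∀ f, ∀ a ∈ K.toSubalgebra, M f a ∈ K.toSubalgebra := fun f a ha =>
    K.sliceRight_comul_mem ha f
  -- `t` represents the functional sending `f` to the trace over `K` of `a ↦ (id ⊗ f)Δ(a)`. For `f =
  -- ε` this operator is the identity, whence `ε(t) = dim K`.
  let t : B := ∑ i, sliceLeft (b.coord i) (comul (R := k) (P (b i)))
  have ht : ∀ f : Module.Dual k B, f t = LinearMap.trace k B (M f ∘ₗ P) := by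
    intro f
    rw [LinearMap.trace_eq_sum_coord b, map_sum]
    simp only [apply_sliceLeft]
    rfl
  have htK : t ∈ K.toSubalgebra := sum_mem fun i _ => K.sliceLeft_comul_mem (hPK _) _
  have hεt : counit (R := k) t = (Module.finrank k V : k) := by
    have h1 := ht (counit (R := k))
    have h2 : M (counit (R := k)) = LinearMap.id := by
      ext a
      simp only [M, sliceRight, LinearMap.comp_apply, LinearEquiv.coe_coe, lTensor_counit_comul]
      simp
    rw [h1, h2, LinearMap.id_comp, LinearMap.trace_comp_comm', hp, LinearMap.trace_id]
  have htx : ∀ x ∈ K.toSubalgebra, x * t = counit (R := k) x • t := by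
    intro x hx
    obtain ⟨s, hs⟩ := K.exists_comul_eq_sum hx
    rw [← sub_eq_zero, ← Module.forall_dual_apply_eq_zero_iff k]
    intro f
    rw [map_sub, map_smul, sub_eq_zero, ht]
    have h1 : f (x * t) = LinearMap.trace k B (M (f ∘ₗ LinearMap.mulLeft k x) ∘ₗ P) := by
      rw [← ht]
      rfl
    -- By the Sweedler identity, `(id ⊗ f(x ·))Δ(a) = ∑ S(x₁) (id ⊗ f)Δ(x₂ a)`. Cyclicity of the
    -- trace will then bring `x₂` next to `S(x₁)`.
    have h2 : M (f ∘ₗ LinearMap.mulLeft k x) ∘ₗ P = ∑ q ∈ s,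
        (LinearMap.mulLeft k (antipode k (q.1 : B)) ∘ₗ P) ∘ₗ
          (M f ∘ₗ LinearMap.mulLeft k (q.2 : B) ∘ₗ P) := by
      ext a
      simp only [LinearMap.sum_apply, LinearMap.comp_apply, LinearMap.mulLeft_apply]
      have h3 : ∀ q ∈ s, P (M f ((q.2 : B) * P a)) = M f ((q.2 : B) * P a) := fun q _ =>
        hPx _ (hMK _ _ (mul_mem q.2.2 (hPK a)))
      rw [Finset.sum_congr rfl fun q hq => by rw [h3 q hq]]
      have h4 : ∀ X : B ⊗[k] B, sliceRight (f ∘ₗ LinearMap.mulLeft k x) X =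
          sliceRight f (((1 : B) ⊗ₜ[k] x) * X) := by
        intro X
        induction X using TensorProduct.induction_on with
        | zero => simp
        | add X₁ X₂ h₁ h₂ => simp only [map_add, h₁, h₂, mul_add]
        | tmul b c => simp
      have h5 : ∀ (c : B) (X : B ⊗[k] B), sliceRight f ((c ⊗ₜ[k] (1 : B)) * X) =
          c * sliceRight f X := by
        intro c X
        induction X using TensorProduct.induction_on with
        | zero => simp
        | add X₁ X₂ h₁ h₂ => simp only [map_add, h₁, h₂, mul_add]
        | tmul b c => simp
      simp only [M, LinearMap.comp_apply]
      rw [h4, ← sum_antipode_tmul_one_mul_comul hs, Finset.sum_mul, map_sum]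
      refine Finset.sum_congr rfl fun q _ => ?_
      rw [mul_assoc, h5, Bialgebra.comul_mul]
    -- The reordered composite contains `∑ x₂ S(x₁) = ε(x)`; this is where `S² = id` enters.
    have h6 : ∑ q ∈ s, (M f ∘ₗ LinearMap.mulLeft k (q.2 : B) ∘ₗ P) ∘ₗ
        (LinearMap.mulLeft k (antipode k (q.1 : B)) ∘ₗ P) = counit (R := k) x • (M f ∘ₗ P) := by
      ext a
      simp only [LinearMap.sum_apply, LinearMap.comp_apply, LinearMap.mulLeft_apply,
        LinearMap.smul_apply]
      have h7 : ∀ q ∈ s, P (antipode k (q.1 : B) * P a) = antipode k (q.1 : B) * P a :=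
        fun q _ => hPx _ (mul_mem (K.antipode_mem _ q.1.2) (hPK a))
      rw [Finset.sum_congr rfl fun q hq => by rw [h7 q hq, ← mul_assoc], ← map_sum,
        ← Finset.sum_mul, sum_mul_antipode_flip hS hs, ← Algebra.smul_def, map_smul]
    rw [h1, h2, map_sum, Finset.sum_congr rfl fun q _ => LinearMap.trace_comp_comm' _ _, ← map_sum,
      h6, map_smul]
  -- Characteristic zero makes `ε(t) = dim K` invertible, so `t` can be normalized.
  have hne : (Module.finrank k V : k) ≠ 0 := by
    have : Nontrivial B := by
      refine nontrivial_of_ne 1 0 fun h => ?_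
      have := congrArg (counit (R := k)) h
      simp at this
    have : Nontrivial V := nontrivial_of_ne (⟨1, one_mem K.toSubalgebra⟩ : V) 0 fun h =>
      one_ne_zero (congrArg Subtype.val h)
    exact Nat.cast_ne_zero.2 Module.finrank_pos.ne'
  refine ⟨(Module.finrank k V : k)⁻¹ • t, Subalgebra.smul_mem _ htK _, ?_, fun x hx => ?_⟩
  · rw [map_smul, hεt, smul_eq_mul, inv_mul_cancel₀ hne]
  · rw [mul_smul_comm, htx x hx, smul_comm]

/-- The antipode of a normalized left integral is a right integral. Evaluating `S(e) e` from either
side identifies the two. -/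
theorem exists_integral [CharZero k] [FiniteDimensional k B]
    (hS : ∀ a : B, antipode k (antipode k a) = a) :
    ∃ e ∈ K.toSubalgebra, counit (R := k) e = 1 ∧ antipode k e = e ∧
      (∀ x ∈ K.toSubalgebra, x * e = counit (R := k) x • e) ∧
      ∀ x ∈ K.toSubalgebra, e * x = counit (R := k) x • e := by
  obtain ⟨e, he, hε, hl⟩ := K.exists_left_integral hS
  have hr : ∀ x ∈ K.toSubalgebra, antipode k e * x = counit (R := k) x • antipode k e := by
    intro x hx
    have := congrArg (antipode k) (hl _ (K.antipode_mem x hx))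
    rwa [antipode_mul_antidistrib, hS, map_smul, counit_antipode] at this
  have hSe : antipode k e = e := by
    have h1 := hl _ (K.antipode_mem e he)
    rwa [hr e he, hε, counit_antipode, hε, one_smul, one_smul] at h1
  exact ⟨e, he, hε, hSe, hl, by rwa [hSe] at hr⟩

/-- `Δ(x) (1 ⊗ e) = x ⊗ e` for `x` in a Hopf subalgebra with left integral `e`. -/
theorem comul_mul_one_tmul_integral {e : B}
    (hl : ∀ x ∈ K.toSubalgebra, x * e = counit (R := k) x • e) {x : B} (hx : x ∈ K.toSubalgebra) :
    comul (R := k) x * ((1 : B) ⊗ₜ[k] e) = x ⊗ₜ[k] e := by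
  obtain ⟨s, hs⟩ := K.exists_comul_eq_sum hx
  have h1 := lTensor_counit_comul (R := k) x
  rw [hs] at h1
  have h2 := congrArg (TensorProduct.rid k B) h1
  simp only [map_sum, LinearMap.lTensor_tmul, TensorProduct.rid_tmul, one_smul] at h2
  rw [hs, Finset.sum_mul]
  conv_rhs => rw [← h2]
  rw [TensorProduct.sum_tmul]
  refine Finset.sum_congr rfl fun p _ => ?_
  rw [Algebra.TensorProduct.tmul_mul_tmul, mul_one, hl _ p.2.2, TensorProduct.tmul_smul,
    TensorProduct.smul_tmul']

/-- `Δ(x) (e ⊗ 1) = e ⊗ x` for `x` in a Hopf subalgebra with left integral `e`. -/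
theorem comul_mul_integral_tmul_one {e : B}
    (hl : ∀ x ∈ K.toSubalgebra, x * e = counit (R := k) x • e) {x : B} (hx : x ∈ K.toSubalgebra) :
    comul (R := k) x * (e ⊗ₜ[k] (1 : B)) = e ⊗ₜ[k] x := by
  obtain ⟨s, hs⟩ := K.exists_comul_eq_sum hx
  have h1 := rTensor_counit_comul (R := k) x
  rw [hs] at h1
  have h2 := congrArg (TensorProduct.lid k B) h1
  simp only [map_sum, LinearMap.rTensor_tmul, TensorProduct.lid_tmul, one_smul] at h2
  rw [hs, Finset.sum_mul]
  conv_rhs => rw [← h2]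
  rw [TensorProduct.tmul_sum]
  refine Finset.sum_congr rfl fun p _ => ?_
  rw [Algebra.TensorProduct.tmul_mul_tmul, mul_one, hl _ p.1.2, TensorProduct.tmul_smul,
    TensorProduct.smul_tmul']

/-- The integral of a normal Hopf subalgebra is central. -/
theorem integral_commute (hK : K.IsNormal) (hS : ∀ a : B, antipode k (antipode k a) = a)
    {e : B} (he : e ∈ K.toSubalgebra) (hε : counit (R := k) e = 1) (hSe : antipode k e = e)
    (hr : ∀ x ∈ K.toSubalgebra, e * x = counit (R := k) x • e) (h : B) : h * e = e * h := by
  -- By normality `ad(a)(e)` lies in `K`, so `e` acts on it through the counit, and `ε(ad(a)(e)) =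
  -- ε(a)`.
  have h1 : ∀ a : B, e * hopfAdjoint k a e = counit (R := k) a • e := by
    intro a
    rw [hr _ (hK a e he)]
    congr 1
    have h2 : ∀ X : B ⊗[k] B, counit (R := k) (sandwichRight k B e X) =
        counit (R := k) (LinearMap.mul' k B ((antipode k).lTensor B X)) := by
      intro X
      induction X using TensorProduct.induction_on with
      | zero => simp
      | add X₁ X₂ h₁ h₂ => simp only [map_add, h₁, h₂]
      | tmul b c => simp [HopfTwist.sandwichRight_tmul, hε]
    rw [hopfAdjoint, h2, mul_antipode_lTensor_comul_apply, Bialgebra.counit_algebraMap]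
  have h3 : ∀ h : B, e * h * e = e * h := by
    intro h
    -- `Ψ` is `a ⊗ b ⊗ c ↦ a e S(b) c`. On the iterated coproduct of `h` it gives `h e` when the
    -- last two legs collapse, and `∑ ad(h₁)(e) h₂` when the first two are grouped; multiplying by
    -- `e` on the left yields `e h e = e h`.
    let Ψ : B ⊗[k] (B ⊗[k] B) →ₗ[k] B := TensorProduct.lift
      ((LinearMap.mul k B).compl₂ (LinearMap.mul' k B ∘ₗ (antipode k).rTensor B) ∘ₗ
        LinearMap.mulRight k e)
    have h4 : ∀ X : B ⊗[k] B, Ψ ((comul (R := k)).lTensor B X) =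
        TensorProduct.rid k B ((counit (R := k)).lTensor B X) * e := by
      intro X
      induction X using TensorProduct.induction_on with
      | zero => simp
      | add X₁ X₂ h₁ h₂ => simp only [map_add, h₁, h₂, add_mul]
      | tmul b c =>
        simp [Ψ, mul_antipode_rTensor_comul_apply, Algebra.algebraMap_eq_smul_one]
    have h5 : ∀ X : B ⊗[k] B, ∀ c : B, Ψ (TensorProduct.assoc k B B B (X ⊗ₜ[k] c)) =
        sandwichRight k B e X * c := by
      intro X c
      induction X using TensorProduct.induction_on with
      | zero => simp
      | add X₁ X₂ h₁ h₂ => simp only [map_add, TensorProduct.add_tmul, h₁, h₂, add_mul]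
      | tmul a b => simp [Ψ, HopfTwist.sandwichRight_tmul, mul_assoc]
    have h6 : ∀ X : B ⊗[k] B, e * Ψ (TensorProduct.assoc k B B B ((comul (R := k)).rTensor B X)) =
        e * TensorProduct.lid k B ((counit (R := k)).rTensor B X) := by
      intro X
      induction X using TensorProduct.induction_on with
      | zero => simp
      | add X₁ X₂ h₁ h₂ => simp only [map_add, mul_add, h₁, h₂]
      | tmul b c =>
        have := h1 b
        rw [hopfAdjoint] at this
        rw [LinearMap.rTensor_tmul, h5, ← mul_assoc, this]
        simp
    have h7 := h6 (comul (R := k) h)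
    rw [coassoc_apply, h4, lTensor_counit_comul, rTensor_counit_comul] at h7
    simpa [mul_assoc] using h7
  -- Applying `S` to `e S(h) e = e S(h)` gives the mirror identity `e h e = h e`.
  have h8 := congrArg (antipode k) (h3 (antipode k h))
  simp only [antipode_mul_antidistrib, hSe, hS] at h8
  rw [← h8, ← mul_assoc, h3]

end HopfSubalgebra

end HopfIntegrals

/-! ### Supports in group algebras, and characters applied to twisted coproducts. -/

section GroupAlgebra

open Coalgebra HopfAlgebra TensorProduct

variable {k : Type*} [Field k]

namespace MonoidAlgebra

variable {G : Type*} [Group G]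

/-- The coefficient at `g`, as a linear functional on the group algebra. -/
noncomputable def coeffFunctional (k : Type*) [Field k] {G : Type*} (g : G) :
    Module.Dual k (MonoidAlgebra k G) :=
  Finsupp.lapply g ∘ₗ (coeffLinearEquiv k).toLinearMap

@[simp]
theorem coeffFunctional_apply {G : Type*} (g : G) (x : MonoidAlgebra k G) :
    coeffFunctional k g x = x.coeff g := rfl

/-- From `Δ(x)(1 ⊗ b) = ∑ x_g g ⊗ g b`. The slices recover each `g b` with its coefficient, so
identities of coproducts become statements about single group elements in the support. -/
theorem sliceLeft_comul_mul (g : G) (x b : MonoidAlgebra k G) :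
    sliceLeft (coeffFunctional k g) (comul (R := k) x * (1 ⊗ₜ[k] b)) =
      x.coeff g • (single g 1 * b) := by
  classical
  induction x using induction_linear with
  | zero => simp
  | add x y hx hy => simp only [map_add, add_mul, hx, hy, coeff_add, Finsupp.add_apply, add_smul]
  | single h c =>
    by_cases hgh : h = g
    · subst hgh
      simp [← smul_mul_assoc]
    · simp [hgh]

theorem sliceRight_comul_mul (g : G) (x w : MonoidAlgebra k G) :
    sliceRight (coeffFunctional k g) (comul (R := k) x * (w ⊗ₜ[k] 1)) =
      x.coeff g • (single g 1 * w) := by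
  classical
  induction x using induction_linear with
  | zero => simp
  | add x y hx hy => simp only [map_add, add_mul, hx, hy, coeff_add, Finsupp.add_apply, add_smul]
  | single h c =>
    by_cases hgh : h = g
    · subst hgh
      simp [← smul_mul_assoc]
    · simp [hgh]

theorem sliceRight_mul_comul (g : G) (x w : MonoidAlgebra k G) :
    sliceRight (coeffFunctional k g) ((w ⊗ₜ[k] 1) * comul (R := k) x) =
      x.coeff g • (w * single g 1) := by
  classical
  induction x using induction_linear with
  | zero => simp
  | add x y hx hy => simp only [map_add, mul_add, hx, hy, coeff_add, Finsupp.add_apply, add_smul]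
  | single h c =>
    by_cases hgh : h = g
    · subst hgh
      simp [← mul_smul_comm]
    · simp [hgh]

theorem antipode_antipode (x : MonoidAlgebra k G) : antipode k (antipode k x) = x := by
  induction x using induction_linear with
  | zero => simp
  | add x y hx hy => simp only [map_add, hx, hy]
  | single h c => simp

/-- The left stabilizer in `G` of an element of the group algebra. -/
def leftStabilizer (e : MonoidAlgebra k G) : Subgroup G where
  carrier := {g | single g 1 * e = e}
  one_mem' := by
    change single 1 1 * e = e
    rw [← one_def, one_mul]
  mul_mem' := by
    intro g h hg hh
    change single (g * h) 1 * e = e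
    have : (single (g * h) 1 : MonoidAlgebra k G) = single g 1 * single h 1 := by
      simp [single_mul_single]
    rw [this, mul_assoc, show single h 1 * e = e from hh, show single g 1 * e = e from hg]
  inv_mem' := by
    intro g hg
    change single g⁻¹ 1 * e = e
    have h : single g 1 * e = e := hg
    conv_lhs => rw [← h]
    rw [← mul_assoc, single_mul_single, inv_mul_cancel, one_mul, ← one_def, one_mul]

theorem mem_leftStabilizer {e : MonoidAlgebra k G} {g : G} :
    g ∈ leftStabilizer e ↔ single g 1 * e = e := Iff.rfl

theorem leftStabilizer_normal {e : MonoidAlgebra k G} (he : ∀ a, a * e = e * a) :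
    (leftStabilizer e).Normal := by
  refine ⟨fun g hg h => ?_⟩
  rw [mem_leftStabilizer] at hg ⊢
  have : (single (h * g * h⁻¹) 1 : MonoidAlgebra k G) = single h 1 * single g 1 * single h⁻¹ 1 := by
    simp [single_mul_single]
  rw [this, mul_assoc, he, ← mul_assoc, mul_assoc (single h 1), hg, he, mul_assoc,
    single_mul_single, mul_inv_cancel, one_mul, ← one_def, mul_one]

theorem coeff_mul_left_of_mem {e : MonoidAlgebra k G} {g : G} (hg : g ∈ leftStabilizer e) (h : G) :
    e.coeff (g * h) = e.coeff h := by
  conv_lhs => rw [← mem_leftStabilizer.1 hg]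
  rw [coeff_single_mul_eq_mul_coeff h (by simp), one_mul]

/-- The slices at `g` of the two sides are `e_g • g e` and `e_g • e`; a nonzero coefficient cancels.
-/
theorem mem_leftStabilizer_of_coeff_ne_zero {e : MonoidAlgebra k G}
    (hΔ : comul (R := k) e * (1 ⊗ₜ[k] e) = e ⊗ₜ[k] e) {g : G} (hg : e.coeff g ≠ 0) :
    g ∈ leftStabilizer e := by
  have h1 := sliceLeft_comul_mul g e e
  rw [hΔ, sliceLeft_tmul, coeffFunctional_apply] at h1
  exact (smul_right_injective _ hg h1).symm

/-- Some coefficient is nonzero, and its group element lies in the stabilizer. Coefficients are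
invariant under translation by the stabilizer, so those at `1` and at `g` agree with it. -/
theorem coeff_ne_zero_of_mem_leftStabilizer {e : MonoidAlgebra k G} (he : e ≠ 0)
    (hΔ : comul (R := k) e * (1 ⊗ₜ[k] e) = e ⊗ₜ[k] e) {g : G} (hg : g ∈ leftStabilizer e) :
    e.coeff g ≠ 0 := by
  obtain ⟨h, hh⟩ : ∃ h, e.coeff h ≠ 0 := by
    by_contra! H
    exact he (MonoidAlgebra.ext (Finsupp.ext H))
  have h1 := mem_leftStabilizer_of_coeff_ne_zero hΔ hh
  rw [← mul_one h, coeff_mul_left_of_mem h1] at hh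
  rwa [← mul_one g, coeff_mul_left_of_mem hg]

theorem eq_of_forall_coeff_ne_zero {A : Type*} [Semiring A] [Algebra k A]
    (f f' : MonoidAlgebra k G →ₗ[k] A) (e : MonoidAlgebra k G)
    (h : ∀ g, e.coeff g ≠ 0 → f (single g 1) = f' (single g 1)) : f e = f' e := by
  classical
  have he : e = e.coeff.sum fun g c => c • single g (1 : k) := by
    conv_lhs => rw [← sum_coeff_single e]
    simp
  rw [he]
  simp only [Finsupp.sum, map_sum, map_smul]
  exact Finset.sum_congr rfl fun g hg => by rw [h g (Finsupp.mem_support_iff.1 hg)]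

end MonoidAlgebra

namespace HopfTwist

variable {A : Type*} [Ring A] [HopfAlgebra k A] (T : HopfTwist k A)

/-- From `S(v) = v` also `S(v⁻¹) = v⁻¹`, and the conjugating factors cancel in `S^J ∘ S^J`. -/
theorem antipode_antipode (hS : ∀ a : A, HopfAlgebra.antipode k (HopfAlgebra.antipode k a) = a)
    (hv : HopfAlgebra.antipode k T.v = T.v) (a : A) : T.antipode (T.antipode a) = a := by
  have h1 : HopfAlgebra.antipode k T.vInv = T.vInv := by
    have h2 := congrArg (HopfAlgebra.antipode k) T.v_mul_vInv
    rw [HopfAlgebra.antipode_mul_antidistrib, hv, HopfAlgebra.antipode_one] at h2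
    exact left_inv_eq_right_inv h2 T.v_mul_vInv
  simp only [antipode_apply, HopfAlgebra.antipode_mul_antidistrib, h1, hv, hS]
  calc T.vInv * (T.v * (a * T.vInv)) * T.v = (T.vInv * T.v) * a * (T.vInv * T.v) := by noncomm_ring
    _ = a := by rw [T.vInv_mul_v, one_mul, mul_one]

/-- For central `e`, both `1 ⊗ e` and `e ⊗ e` commute with `J`, so the conjugation by `J` in `Δ^J`
can be undone. -/
theorem comul_mul_of_commute {e : A} (he : ∀ a, a * e = e * a)
    (h : T.comul e * (1 ⊗ₜ[k] e) = e ⊗ₜ[k] e) :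
    Coalgebra.comul (R := k) e * (1 ⊗ₜ[k] e) = e ⊗ₜ[k] e := by
  have h1 : ∀ X : A ⊗[k] A, X * (1 ⊗ₜ[k] e) = (1 ⊗ₜ[k] e) * X := by
    intro X
    induction X using TensorProduct.induction_on with
    | zero => simp
    | add X₁ X₂ h₁ h₂ => simp only [add_mul, mul_add, h₁, h₂]
    | tmul b c => simp [he]
  have h2 : ∀ X : A ⊗[k] A, X * (e ⊗ₜ[k] e) = (e ⊗ₜ[k] e) * X := by
    intro X
    induction X using TensorProduct.induction_on with
    | zero => simp
    | add X₁ X₂ h₁ h₂ => simp only [add_mul, mul_add, h₁, h₂]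
    | tmul b c => simp [he]
  rw [comul_apply, mul_assoc, h1, mul_assoc, Units.inv_mul_eq_iff_eq_mul, h2, ← mul_assoc] at h
  exact (Units.mul_left_inj _).1 h

/-- If `σ` is a character of `A`, this is `(id ⊗ σ)` as an algebra map `A ⊗ A → A`. -/
noncomputable def evalRight (σ : A →ₐ[k] k) : A ⊗[k] A →ₐ[k] A :=
  (Algebra.TensorProduct.rid k k A).toAlgHom.comp
    (Algebra.TensorProduct.map (AlgHom.id k A) σ)

/-- If `σ` is a character of `A`, this is `(σ ⊗ id)` as an algebra map `A ⊗ A → A`. -/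
noncomputable def evalLeft (σ : A →ₐ[k] k) : A ⊗[k] A →ₐ[k] A :=
  (Algebra.TensorProduct.lid k A).toAlgHom.comp
    (Algebra.TensorProduct.map σ (AlgHom.id k A))

@[simp]
theorem evalRight_tmul (σ : A →ₐ[k] k) (a b : A) : evalRight σ (a ⊗ₜ[k] b) = σ b • a := by
  simp [evalRight]

@[simp]
theorem evalLeft_tmul (σ : A →ₐ[k] k) (a b : A) : evalLeft σ (a ⊗ₜ[k] b) = σ a • b := by
  simp [evalLeft]

theorem evalRight_comul_eq_evalLeft_comul [Coalgebra.IsCocomm k A] (σ : A →ₐ[k] k) (x : A) :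
    evalRight σ (Coalgebra.comul (R := k) x) = evalLeft σ (Coalgebra.comul (R := k) x) := by
  have h : ∀ X : A ⊗[k] A, evalRight σ (TensorProduct.comm k A A X) = evalLeft σ X := by
    intro X
    induction X using TensorProduct.induction_on with
    | zero => simp
    | add X₁ X₂ h₁ h₂ => simp only [map_add, h₁, h₂]
    | tmul b c => simp
  rw [← h, Coalgebra.comm_comul]

/-- Elements that are invariant under `σ` on both sides with respect to `Δ^J` commute with
`(id ⊗ σ)(J)⁻¹ (σ ⊗ id)(J)`. -/
theorem commute_of_eval_comul_eq [Coalgebra.IsCocomm k A] (σ : A →ₐ[k] k) {x w : A}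
    (hr : evalRight σ (T.comul x) = x) (hl : evalLeft σ (T.comul x) = x)
    (hw : evalRight σ (T.J : A ⊗[k] A) * w = evalLeft σ (T.J : A ⊗[k] A)) : x * w = w * x := by
  -- An algebra map `f` with `f(Δ^J(x)) = x` turns `Δ(x) J = J Δ^J(x)` into an intertwining
  -- relation. Cocommutativity gives both evaluations the same `f(Δ(x))`, so the two relations can
  -- be compared.
  have key : ∀ f : A ⊗[k] A →ₐ[k] A, f (T.comul x) = x →
      f (Coalgebra.comul (R := k) x) * f (T.J : A ⊗[k] A) = f (T.J : A ⊗[k] A) * x := by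
    intro f hf
    conv_rhs => rw [← hf, comul_apply, ← map_mul, ← mul_assoc, ← mul_assoc, Units.mul_inv, one_mul,
      map_mul]
  have h1 := key _ hr
  have h2 := key _ hl
  have hu : evalRight σ ((T.J⁻¹ : (A ⊗[k] A)ˣ) : A ⊗[k] A) * evalRight σ (T.J : A ⊗[k] A) = 1 := by
    rw [← map_mul, Units.inv_mul, map_one]
  rw [← evalRight_comul_eq_evalLeft_comul, ← hw, ← mul_assoc, h1, mul_assoc, mul_assoc] at h2
  have h3 := congrArg (evalRight σ ((T.J⁻¹ : (A ⊗[k] A)ˣ) : A ⊗[k] A) * ·) h2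
  simpa only [← mul_assoc, hu, one_mul] using h3

end HopfTwist

end GroupAlgebra

/-! ### Abelian twists and invariance under a character. -/

section AbelianTwistLemmas

open TensorProduct

variable {k : Type*} [Field k] {G : Type*} [Group G]

namespace MonoidAlgebra

theorem single_commute_of_comul_commute {x w : MonoidAlgebra k G}
    (h : Coalgebra.comul (R := k) x * (w ⊗ₜ[k] 1) = (w ⊗ₜ[k] 1) * Coalgebra.comul (R := k) x)
    {g : G} (hg : x.coeff g ≠ 0) : single g 1 * w = w * single g 1 := by
  have h1 := sliceRight_comul_mul g x w
  rw [h, sliceRight_mul_comul] at h1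
  exact (smul_right_injective _ hg h1).symm

/-- An element of `kH` commuting with some `g ∈ G` such that `g h g⁻¹ ∉ H` for all nontrivial
`h ∈ H` is a scalar. -/
theorem eq_single_one_of_commute {H : Subgroup G} {w : MonoidAlgebra k G}
    (hw : ∀ h ∉ H, w.coeff h = 0) {g : G} (hg : ∀ h ∈ H, h ≠ 1 → g * h * g⁻¹ ∉ H)
    (hc : single g 1 * w = w * single g 1) : w = single 1 (w.coeff 1) := by
  refine MonoidAlgebra.ext (Finsupp.ext fun h => ?_)
  by_cases h1 : h = 1
  · subst h1
    simp
  rw [coeff_single, Finsupp.single_eq_of_ne h1]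
  by_cases hH : h ∈ H
  -- At `g h`, the coefficient of `g w` is `w_h` and that of `w g` is `w_{g h g⁻¹}`, which vanishes
  -- outside `H`.
  · have h2 := congrArg (fun x => x.coeff (g * h)) hc
    rw [coeff_single_mul_eq_mul_coeff h (by simp),
      coeff_mul_single_eq_coeff_mul (g * h * g⁻¹) (by simp [eq_mul_inv_iff_mul_eq]), one_mul,
      mul_one, hw _ (hg h hH h1)] at h2
    exact h2
  · exact hw h hH

end MonoidAlgebra

theorem IsNormalizedTwoCocycle.apply_inv {Γ M : Type*} [Group Γ] [CommGroup M] {ω : Γ → Γ → M}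
    (hω : IsNormalizedTwoCocycle ω) (α : Γ) : ω α α⁻¹ = ω α⁻¹ α := by
  have := hω.cocycle α α⁻¹ α
  rwa [mul_inv_cancel, inv_mul_cancel, hω.one_left, hω.one_right, one_mul, one_mul] at this

variable (H : Subgroup G) [Finite G]

theorem antipode_charIdempotent (χ : CharGroup k H) :
    HopfAlgebra.antipode k (charIdempotent k H χ) = charIdempotent k H χ⁻¹ := by
  let _ := Fintype.ofFinite H
  simp only [charIdempotent, map_smul, map_sum, MonoidAlgebra.antipode_single]
  congr 1
  rw [← Equiv.sum_comp (Equiv.inv H)]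
  simp

theorem coeff_charIdempotent_of_notMem (χ : CharGroup k H) {g : G} (hg : g ∉ H) :
    (charIdempotent k H χ).coeff g = 0 := by
  let _ := Fintype.ofFinite H
  simp only [charIdempotent, MonoidAlgebra.coeff_smul, MonoidAlgebra.coeff_sum, Finsupp.smul_apply,
    Finsupp.finsetSum_apply, MonoidAlgebra.coeff_single]
  rw [Finset.sum_eq_zero, smul_zero]
  intro h _
  rw [Finsupp.single_eq_of_ne (fun h' : g = h => hg (by rw [h']; exact h.2)), smul_zero]

theorem charIdempotent_ne_zero [CharZero k] (χ : CharGroup k H) : charIdempotent k H χ ≠ 0 := by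
  classical
  let _ := Fintype.ofFinite H
  intro h0
  have h : (charIdempotent k H χ).coeff 1 = 0 := by rw [h0]; rfl
  simp only [charIdempotent, MonoidAlgebra.coeff_smul, MonoidAlgebra.coeff_sum, Finsupp.smul_apply,
    Finsupp.finsetSum_apply, MonoidAlgebra.coeff_single] at h
  rw [Finset.sum_eq_single 1 (fun b _ hb => by
    rw [Finsupp.single_eq_of_ne (fun h' : (1 : G) = b => hb (Subtype.ext h'.symm)), smul_zero]) (by simp)] at h
  simp at h

/-- The algebra map `kG → k` attached to a character of `G`. -/
noncomputable def charAlgHom (s : CharGroup k G) : MonoidAlgebra k G →ₐ[k] k :=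
  MonoidAlgebra.lift k k G ((Units.coeHom k).comp s)

@[simp]
theorem charAlgHom_single {G : Type*} [Group G] (s : CharGroup k G) (g : G) (c : k) :
    charAlgHom s (MonoidAlgebra.single g c) = c * s g := by
  simp [charAlgHom]

open scoped Classical in
theorem charAlgHom_charIdempotent [CharZero k] (s : CharGroup k G) (χ : CharGroup k H) :
    charAlgHom s (charIdempotent k H χ) = if χ = s.comp H.subtype then 1 else 0 := by
  let _ := Fintype.ofFinite H
  have hcard : (Nat.card H : k) ≠ 0 := Nat.cast_ne_zero.2 Nat.card_pos.ne'
  have h2 := sum_hom_units_dual k (χ⁻¹ * s.comp H.subtype)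
  have h3 : ∀ x : H, (χ x⁻¹ : k) * (s x : k) = ((χ⁻¹ * s.comp H.subtype) x : kˣ) := by
    intro x
    simp
  simp only [charIdempotent, map_smul, map_sum, charAlgHom_single, smul_eq_mul, one_mul, h3, h2]
  by_cases h : χ = s.comp H.subtype
  · rw [if_pos h, h, if_pos (inv_mul_cancel _), inv_mul_cancel₀ hcard]
  · rw [if_neg h, if_neg (fun h' => h (inv_mul_eq_one.1 h')), mul_zero]

variable [CharZero k]

theorem sum_smul_charIdempotent_mul [Fintype (CharGroup k H)] (f g : CharGroup k H → k) :
    (∑ α, f α • charIdempotent k H α) * (∑ α, g α • charIdempotent k H α) =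
      ∑ α, (f α * g α) • charIdempotent k H α := by
  classical
  simp only [Finset.sum_mul_sum, smul_mul_smul_comm, charIdempotent_mul]
  refine Finset.sum_congr rfl fun α _ => ?_
  rw [Finset.sum_eq_single α (fun b _ hb => by simp [hb.symm]) (by simp), if_pos rfl]

variable [IsAlgClosed k] [IsMulCommutative H] {ω : CharGroup k H → CharGroup k H → kˣ}
  (hω : IsNormalizedTwoCocycle ω)

theorem abelianTwist_J [hf : Fintype (CharGroup k H)] :
    ((abelianTwist k H ω hω).J : MonoidAlgebra k G ⊗[k] MonoidAlgebra k G) =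
      ∑ α, ∑ β, (ω α β : k) • (charIdempotent k H α ⊗ₜ[k] charIdempotent k H β) := by
  obtain rfl : hf = Fintype.ofFinite (CharGroup k H) := Subsingleton.elim _ _
  rfl

/-- Orthogonality of the idempotents gives `v = ∑ ω(α, α⁻¹) e_{α⁻¹}`. The antipode exchanges `e_α`
and `e_{α⁻¹}`, and `ω(α, α⁻¹) = ω(α⁻¹, α)` for a normalized cocycle. -/
theorem antipode_abelianTwist_v :
    HopfAlgebra.antipode k (abelianTwist k H ω hω).v = (abelianTwist k H ω hω).v := by
  classical
  let _ := Fintype.ofFinite (CharGroup k H)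
  have h1 : (abelianTwist k H ω hω).v =
      ∑ α, (ω α α⁻¹ : k) • charIdempotent k H α⁻¹ := by
    rw [HopfTwist.v, abelianTwist_J]
    simp only [map_sum, map_smul, HopfTwist.sandwichLeft_tmul, antipode_charIdempotent, mul_one,
      charIdempotent_mul]
    refine Finset.sum_congr rfl fun α _ => ?_
    rw [Finset.sum_eq_single α⁻¹ (fun b _ hb => by simp [hb.symm]) (by simp), if_pos rfl]
  rw [h1]
  simp only [map_sum, map_smul, antipode_charIdempotent]
  rw [← Equiv.sum_comp (Equiv.inv (CharGroup k H))]
  simp [hω.apply_inv]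

theorem evalRight_abelianTwist_J [Fintype (CharGroup k H)] (s : CharGroup k G) :
    HopfTwist.evalRight (charAlgHom s)
      ((abelianTwist k H ω hω).J : MonoidAlgebra k G ⊗[k] MonoidAlgebra k G) =
      ∑ α, (ω α (s.comp H.subtype) : k) • charIdempotent k H α := by
  classical
  rw [abelianTwist_J]
  simp only [map_sum, map_smul, HopfTwist.evalRight_tmul, charAlgHom_charIdempotent]
  simp

theorem evalLeft_abelianTwist_J [Fintype (CharGroup k H)] (s : CharGroup k G) :
    HopfTwist.evalLeft (charAlgHom s)
      ((abelianTwist k H ω hω).J : MonoidAlgebra k G ⊗[k] MonoidAlgebra k G) =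
      ∑ α, (ω (s.comp H.subtype) α : k) • charIdempotent k H α := by
  classical
  rw [abelianTwist_J]
  simp only [map_sum, map_smul, HopfTwist.evalLeft_tmul, charAlgHom_charIdempotent]
  rw [Finset.sum_comm]
  simp

theorem abelianTwist_J_commute [Fintype (CharGroup k H)] (f : CharGroup k H → k) :
    Commute ((abelianTwist k H ω hω).J : MonoidAlgebra k G ⊗[k] MonoidAlgebra k G)
      ((∑ α, f α • charIdempotent k H α) ⊗ₜ[k] 1) := by
  classical
  have h : ∀ β, charIdempotent k H β * (∑ α, f α • charIdempotent k H α) =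
      (∑ α, f α • charIdempotent k H α) * charIdempotent k H β := by
    intro β
    have := sum_smul_charIdempotent_mul (k := k) H (Pi.single β 1) f
    have h' := sum_smul_charIdempotent_mul (k := k) H f (Pi.single β 1)
    simp_rw [mul_comm (f _)] at h'
    rw [← this] at h'
    simpa [Pi.single_apply] using h'.symm
  rw [abelianTwist_J]
  refine Commute.sum_left _ _ _ fun α _ => Commute.sum_left _ _ _ fun β _ =>
    Commute.smul_left ?_ _
  rw [Commute, SemiconjBy]
  simp only [Algebra.TensorProduct.tmul_mul_tmul, h, mul_one, one_mul]

/-- If `Δ^J(e) = ∑ xᵢ ⊗ yᵢ`, where the `xᵢ` are invariant under a character `s` on both sides, and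
the support of `e` contains an element `g` with `g h g⁻¹ ∉ H` for all nontrivial `h ∈ H`, then
`ω(s|_H, α) = ω(α, s|_H)` for all `α`. -/
theorem cocycle_symm_of_invariant (s : CharGroup k G) {e : MonoidAlgebra k G}
    {ι : Type*} {t : Finset ι} {x y : ι → MonoidAlgebra k G}
    (he : (abelianTwist k H ω hω).comul e = ∑ i ∈ t, x i ⊗ₜ[k] y i)
    (hr : ∀ i ∈ t, HopfTwist.evalRight (charAlgHom s) ((abelianTwist k H ω hω).comul (x i)) = x i)
    (hl : ∀ i ∈ t, HopfTwist.evalLeft (charAlgHom s) ((abelianTwist k H ω hω).comul (x i)) = x i)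
    {g : G} (hge : e.coeff g ≠ 0) (hg : ∀ h ∈ H, h ≠ 1 → g * h * g⁻¹ ∉ H) (α : CharGroup k H) :
    ω (s.comp H.subtype) α = ω α (s.comp H.subtype) := by
  classical
  let _ := Fintype.ofFinite (CharGroup k H)
  set T := abelianTwist k H ω hω with hT
  -- `b` measures the asymmetry of `ω` at `s|_H`; it gives the eigenvalues of `w = (id ⊗ s)(J)⁻¹ (s
  -- ⊗ id)(J)` on the idempotents.
  let b : CharGroup k H → k := fun α =>
    (ω α (s.comp H.subtype) : k)⁻¹ * (ω (s.comp H.subtype) α : k)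
  let w : MonoidAlgebra k G := ∑ α, b α • charIdempotent k H α
  have hw : HopfTwist.evalRight (charAlgHom s) (T.J : MonoidAlgebra k G ⊗[k] MonoidAlgebra k G) * w
      = HopfTwist.evalLeft (charAlgHom s) (T.J : MonoidAlgebra k G ⊗[k] MonoidAlgebra k G) := by
    rw [hT, evalRight_abelianTwist_J, evalLeft_abelianTwist_J, sum_smul_charIdempotent_mul]
    exact Finset.sum_congr rfl fun α _ => by rw [mul_inv_cancel_left₀ (Units.ne_zero _)]
  have hx : ∀ i ∈ t, x i * w = w * x i := fun i hi =>
    T.commute_of_eval_comul_eq _ (hr i hi) (hl i hi) hw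
  have h1 : Commute (T.comul e) (w ⊗ₜ[k] (1 : MonoidAlgebra k G)) := by
    rw [he]
    refine Commute.sum_left _ _ _ fun i hi => ?_
    rw [Commute, SemiconjBy]
    simp only [Algebra.TensorProduct.tmul_mul_tmul, hx i hi, mul_one, one_mul]
  -- `J` lies in `kH ⊗ kH` with `kH` commutative, so commutation with `w ⊗ 1` passes from `Δ^J(e)`
  -- to `Δ(e)`, and from there to each `g` in the support of `e`.
  have hJ : Commute (T.J : MonoidAlgebra k G ⊗[k] MonoidAlgebra k G) (w ⊗ₜ[k] 1) :=
    abelianTwist_J_commute H hω b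
  have h2 : Commute (Coalgebra.comul (R := k) e) (w ⊗ₜ[k] (1 : MonoidAlgebra k G)) := by
    have h3 : Coalgebra.comul (R := k) e = (T.J : MonoidAlgebra k G ⊗[k] MonoidAlgebra k G) *
        T.comul e * ((T.J⁻¹ : (MonoidAlgebra k G ⊗[k] MonoidAlgebra k G)ˣ) :
          MonoidAlgebra k G ⊗[k] MonoidAlgebra k G) := by
      rw [HopfTwist.comul_apply, ← mul_assoc, ← mul_assoc, Units.mul_inv, one_mul, mul_assoc,
        Units.mul_inv, mul_one]
    rw [h3]
    exact (hJ.mul_left h1).mul_left (Commute.units_inv_left hJ)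
  have h4 := MonoidAlgebra.single_commute_of_comul_commute h2.eq hge
  have hsupp : ∀ h ∉ H, w.coeff h = 0 := by
    intro h hh
    simp only [w, MonoidAlgebra.coeff_sum, MonoidAlgebra.coeff_smul, Finsupp.finsetSum_apply,
      Finsupp.smul_apply, coeff_charIdempotent_of_notMem H _ hh, smul_zero, Finset.sum_const_zero]
  have h5 := MonoidAlgebra.eq_single_one_of_commute hsupp hg h4
  -- As `w` is a scalar, `b` is constant; normalization of `ω` fixes its value to be `1` at the
  -- trivial character.
  have h6 : ∀ α, b α = w.coeff 1 := by
    intro α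
    have h7 : w * charIdempotent k H α = b α • charIdempotent k H α := by
      have := sum_smul_charIdempotent_mul (k := k) H b (Pi.single α 1)
      simpa [Pi.single_apply] using this
    rw [h5] at h7
    have h8 : (MonoidAlgebra.single 1 (w.coeff 1) : MonoidAlgebra k G) * charIdempotent k H α =
        w.coeff 1 • charIdempotent k H α := by
      rw [show (MonoidAlgebra.single 1 (w.coeff 1) : MonoidAlgebra k G) = w.coeff 1 • 1 by
        simp [MonoidAlgebra.one_def], smul_mul_assoc, one_mul]
    rw [h8] at h7
    exact (smul_left_injective k (charIdempotent_ne_zero H α) h7).symm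
  have h9 : b α = 1 := by
    rw [h6, ← h6 1]
    simp [b, hω.one_left, hω.one_right]
  refine Units.ext ?_
  simp only [b] at h9
  rwa [inv_mul_eq_one₀ (Units.ne_zero _), eq_comm] at h9

end AbelianTwistLemmas

/-! ### Cocycles on the Klein four-group. -/

/-- A normalized `2`-cocycle on a Klein four-group with values in the units of an algebraically
closed field that is symmetric at one nontrivial element is a coboundary. -/
theorem IsNormalizedTwoCocycle.isTwoCoboundary_of_symm {k Γ : Type*} [Field k] [IsAlgClosed k]
    [CommGroup Γ] {ω : Γ → Γ → kˣ} (hω : IsNormalizedTwoCocycle ω) {r s : Γ} (hs : s * s = 1)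
    (hr : r * r = 1) (hs1 : s ≠ 1) (hr1 : r ≠ 1) (hrs : r ≠ s)
    (hΓ : ∀ α, α = 1 ∨ α = s ∨ α = r ∨ α = s * r) (hsymm : ∀ α, ω s α = ω α s) :
    IsTwoCoboundary ω := by
  classical
  have hsqrt : ∀ x : kˣ, ∃ y : kˣ, y * y = x := by
    intro x
    obtain ⟨z, hz⟩ := IsAlgClosed.exists_pow_nat_eq (x : k) (n := 2) (by norm_num)
    have hz0 : z ≠ 0 := by
      rintro rfl
      exact x.ne_zero (by simpa using hz.symm)
    exact ⟨Units.mk0 z hz0, Units.ext (by simpa [sq] using hz)⟩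
  obtain ⟨a, ha⟩ := hsqrt (ω s s)
  obtain ⟨b, hb⟩ := hsqrt (ω r r)
  have hsr1 : s * r ≠ 1 := fun h => hrs (by
    rw [← one_mul r, ← hs, mul_assoc, h, mul_one])
  have hsrs : s * r ≠ s := fun h => hr1 (mul_eq_left.1 h)
  have hsrr : s * r ≠ r := fun h => hs1 (mul_eq_right.1 h)
  have m1 : s * (s * r) = r := by rw [← mul_assoc, hs, one_mul]
  have m2 : r * (s * r) = s := by rw [mul_left_comm, hr, mul_one]
  have m3 : s * r * s = r := by rw [mul_comm, m1]
  have m4 : s * r * r = s := by rw [mul_assoc, hr, mul_one]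
  have m5 : s * r * (s * r) = 1 := by rw [← mul_assoc, m3, hr]
  -- The cocycle identity determines the remaining values of `ω` from `ω(s,s) = a²`, `ω(r,r) = b²`
  -- and `ω(s,r)`. Symmetry at `s` is what makes `ω(r,s)` no additional parameter.
  have w1 : ω s (s * r) * ω s r = a * a := by
    have := hω.cocycle s s r
    rw [hs, hω.one_left, one_mul] at this
    rw [← this, ha]
  have w2 : ω (s * r) r * ω s r = b * b := by
    have := hω.cocycle s r r
    rwa [hr, hω.one_right, one_mul, ← hb] at this
  have w3 : ω r (s * r) * ω s r = b * b := by
    have := hω.cocycle r r s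
    rw [hr, hω.one_left, one_mul, mul_comm r s, ← hsymm r] at this
    rw [← this, hb]
  have w4 : ω (s * r) (s * r) * ω s r * ω s r = a * a * (b * b) := by
    have := hω.cocycle s r (s * r)
    rw [m2] at this
    rw [this, mul_assoc, w3, ha]
  have e1 : ω s (s * r) = a * a / ω s r := eq_div_of_mul_eq' w1
  have e2 : ω (s * r) r = b * b / ω s r := eq_div_of_mul_eq' w2
  have e3 : ω r (s * r) = b * b / ω s r := eq_div_of_mul_eq' w3
  have e4 : ω (s * r) (s * r) = a * a * (b * b) / ω s r / ω s r :=
    eq_div_of_mul_eq' (eq_div_of_mul_eq' w4)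
  -- The coboundary equation at `(s,s)`, `(r,r)` and `(s,r)` dictates these values of `f`; the
  -- square roots exist because `k` is algebraically closed.
  obtain ⟨f, f1, fs, fr, fsr⟩ : ∃ f : Γ → kˣ, f 1 = 1 ∧ f s = a ∧ f r = b ∧
      f (s * r) = a * b / ω s r := by
    refine ⟨fun α => if α = 1 then 1 else if α = s then a else if α = r then b else a * b / ω s r,
      ?_, ?_, ?_, ?_⟩
    · dsimp only
      rw [if_pos rfl]
    · dsimp only
      rw [if_neg hs1, if_pos rfl]
    · dsimp only
      rw [if_neg hr1, if_neg hrs, if_pos rfl]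
    · dsimp only
      rw [if_neg hsr1, if_neg hsrs, if_neg hsrr]
  refine ⟨f, fun α β => ?_⟩
  rcases hΓ α with h | h | h | h <;> rcases hΓ β with h' | h' | h' | h' <;>
    rw [h, h'] <;>
    simp only [hω.one_left, hω.one_right, one_mul, mul_one, hs, hr, m1, m2, m3, m4, m5,
      mul_comm r s, f1, fs, fr, fsr, div_self', div_one, ← hsymm, ← ha, ← hb, e1, e2, e3, e4] <;>
    (refine Units.ext ?_; push_cast; field_simp)

theorem Subgroup.mem_closure_pair_of_involutive {G : Type*} [Group G] {a b : G} (ha : a * a = 1)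
    (hb : b * b = 1) (hab : a * b = b * a) {x : G} (hx : x ∈ Subgroup.closure {a, b}) :
    x = 1 ∨ x = a ∨ x = b ∨ x = a * b := by
  have ha' : a⁻¹ = a := inv_eq_of_mul_eq_one_left ha
  have hb' : b⁻¹ = b := inv_eq_of_mul_eq_one_left hb
  have ha2 : ∀ y, a * (a * y) = y := fun y => by rw [← mul_assoc, ha, one_mul]
  have hba : b * (a * b) = a := by rw [← mul_assoc, ← hab, mul_assoc, hb, mul_one]
  have key : ∀ g ∈ ({a, b} : Set G), ∀ y, (y = 1 ∨ y = a ∨ y = b ∨ y = a * b) →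
      (g * y = 1 ∨ g * y = a ∨ g * y = b ∨ g * y = a * b) := by
    rintro g (rfl | rfl) y (rfl | rfl | rfl | rfl) <;> simp [ha, ha2, hb, hba, ← hab]
  induction hx using Subgroup.closure_induction_left with
  | one => exact Or.inl rfl
  | mul_left g hg y _ ih => exact key g hg y ih
  | inv_mul_cancel g hg y _ ih =>
    have : g⁻¹ = g := by rcases hg with rfl | rfl <;> assumption
    rw [this]
    exact key g hg y ih

/-- A normalized `2`-cocycle on the character group of a Klein four-group `{1, a, b, ab}` that is
symmetric at the character `s` with `s(a) = s(b) = -1` is a coboundary. -/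
theorem isTwoCoboundary_of_symm_at_sign {k H : Type*} [Field k] [IsAlgClosed k] [CharZero k]
    [Group H] [IsMulCommutative H] {a b : H} (ha : a * a = 1) (hb : b * b = 1) (hab : a * b ≠ 1)
    (hH : ∀ x, x = 1 ∨ x = a ∨ x = b ∨ x = a * b) {s : CharGroup k H} (hsa : s a = -1)
    (hsb : s b = -1) {ω : CharGroup k H → CharGroup k H → kˣ} (hω : IsNormalizedTwoCocycle ω)
    (hsymm : ∀ α, ω s α = ω α s) : IsTwoCoboundary ω := by
  have : Finite H := by
    classical
    refine Finite.of_surjective (fun i : Fin 4 => ![1, a, b, a * b] i) fun x => ?_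
    rcases hH x with rfl | rfl | rfl | rfl
    exacts [⟨0, rfl⟩, ⟨1, rfl⟩, ⟨2, rfl⟩, ⟨3, rfl⟩]
  -- Since `s(ab) = 1`, a character `r` with `r(ab) ≠ 1` is nontrivial and distinct from `s`.
  obtain ⟨r, hr⟩ : ∃ r : CharGroup k H, r (a * b) ≠ 1 := by
    let _ : CommGroup H := { mul_comm := fun a b => IsMulCommutative.is_comm.comm a b }
    exact CommGroup.exists_apply_ne_one_of_hasEnoughRootsOfUnity H k hab
  have hext : ∀ χ ψ : CharGroup k H, χ a = ψ a → χ b = ψ b → χ = ψ := by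
    intro χ ψ h1 h2
    ext x
    rcases hH x with rfl | rfl | rfl | rfl <;> simp [h1, h2]
  have hval : ∀ (χ : CharGroup k H) (x : H), x * x = 1 → χ x = 1 ∨ χ x = -1 := by
    intro χ x hx
    have h1 : (χ x : k) * χ x = 1 := by rw [← Units.val_mul, ← map_mul, hx, map_one, Units.val_one]
    rcases mul_self_eq_one_iff.1 h1 with h | h
    · exact Or.inl (Units.ext h)
    · exact Or.inr (Units.ext (by simpa using h))
  have hne : (1 : kˣ) ≠ -1 := by
    intro h
    have h1 := congrArg (Units.val) h
    simp only [Units.val_one, Units.val_neg] at h1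
    have : (2 : k) = 0 := by linear_combination h1
    exact two_ne_zero this
  have hsq : ∀ χ : CharGroup k H, χ * χ = 1 := by
    intro χ
    refine hext _ _ ?_ ?_
    · rcases hval χ a ha with h | h <;> simp [h]
    · rcases hval χ b hb with h | h <;> simp [h]
  rw [map_mul] at hr
  refine hω.isTwoCoboundary_of_symm (r := r) (s := s) (hsq s) (hsq r) ?_ ?_ ?_ ?_ hsymm
  · rintro rfl
    simp only [MonoidHom.one_apply] at hsa
    exact hne hsa
  · rintro rfl
    simp at hr
  · rintro rfl
    simp [hsa, hsb] at hr
  · intro χ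
    -- The condition `r(ab) ≠ 1` leaves exactly one of `r(a)`, `r(b)` equal to `-1`; the four sign
    -- patterns of `χ` on `a, b` are then those of `1`, `s`, `r` and `sr`.
    rcases hval r a ha with h1 | h1 <;> rcases hval r b hb with h2 | h2
    · simp [h1, h2] at hr
    · rcases hval χ a ha with h3 | h3 <;> rcases hval χ b hb with h4 | h4
      · exact Or.inl (hext _ _ (by simp [h3]) (by simp [h4]))
      · exact Or.inr (Or.inr (Or.inl (hext _ _ (by simp [h1, h3]) (by simp [h2, h4]))))
      · exact Or.inr (Or.inr (Or.inr (hext _ _ (by simp [h1, h3, hsa]) (by simp [h2, h4, hsb]))))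
      · exact Or.inr (Or.inl (hext _ _ (by simp [h3, hsa]) (by simp [h4, hsb])))
    · rcases hval χ a ha with h3 | h3 <;> rcases hval χ b hb with h4 | h4
      · exact Or.inl (hext _ _ (by simp [h3]) (by simp [h4]))
      · exact Or.inr (Or.inr (Or.inr (hext _ _ (by simp [h1, h3, hsa]) (by simp [h2, h4, hsb]))))
      · exact Or.inr (Or.inr (Or.inl (hext _ _ (by simp [h1, h3]) (by simp [h2, h4]))))
      · exact Or.inr (Or.inl (hext _ _ (by simp [h3, hsa]) (by simp [h4, hsb])))
    · simp [h1, h2] at hr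

/-! ### Permutations and the sign character. -/

/-- The transposition `(1 2)` in `S_n`. -/
def firstTransposition (n : ℕ) (hn : 4 ≤ n) : Equiv.Perm (Fin n) :=
  Equiv.swap ⟨0, by omega⟩ ⟨1, by omega⟩

/-- The transposition `(3 4)` in `S_n`. -/
def secondTransposition (n : ℕ) (hn : 4 ≤ n) : Equiv.Perm (Fin n) :=
  Equiv.swap ⟨2, by omega⟩ ⟨3, by omega⟩

theorem firstTransposition_mem (n : ℕ) (hn : 4 ≤ n) :
    firstTransposition n hn ∈ twoTranspositions n hn :=
  Subgroup.subset_closure (Or.inl rfl)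

theorem secondTransposition_mem (n : ℕ) (hn : 4 ≤ n) :
    secondTransposition n hn ∈ twoTranspositions n hn :=
  Subgroup.subset_closure (Or.inr rfl)

theorem mem_twoTranspositions {n : ℕ} {hn : 4 ≤ n} {x : Equiv.Perm (Fin n)}
    (hx : x ∈ twoTranspositions n hn) : x = 1 ∨ x = firstTransposition n hn ∨
      x = secondTransposition n hn ∨ x = firstTransposition n hn * secondTransposition n hn := by
  refine Subgroup.mem_closure_pair_of_involutive (Equiv.swap_mul_self _ _)
    (Equiv.swap_mul_self _ _) ?_ hx
  exact congrArg Subtype.val (mul_comm' (⟨_, firstTransposition_mem n hn⟩ :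
    twoTranspositions n hn) ⟨_, secondTransposition_mem n hn⟩)

/-- Elements of the subgroup preserve `{0, 1}`. The 3-cycle `0 ↦ 1 ↦ 2 ↦ 0` conjugates its
nontrivial elements to `(1 2)`, `(0 3)` and `(1 2)(0 3)` on the letters of `Fin n`, none of which
does. -/
theorem exists_mem_alternatingGroup_conj_notMem (n : ℕ) (hn : 4 ≤ n) :
    ∃ g ∈ alternatingGroup (Fin n), ∀ h ∈ twoTranspositions n hn, h ≠ 1 →
      g * h * g⁻¹ ∉ twoTranspositions n hn := by
  let i : Fin 4 → Fin n := fun j => ⟨j, by omega⟩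
  have hi : ∀ {j l : Fin 4}, j ≠ l → i j ≠ i l := fun h h' => h (Fin.ext (Fin.mk.inj h'))
  have hstab : ∀ x ∈ twoTranspositions n hn, (x (i 0) = i 0 ∨ x (i 0) = i 1) ∧
      (x (i 1) = i 0 ∨ x (i 1) = i 1) := by
    intro x hx
    rcases mem_twoTranspositions hx with rfl | rfl | rfl | rfl <;>
      simp [firstTransposition, secondTransposition, i, Equiv.swap_apply_def]
  have hg : ∀ z, (Equiv.swap (i 0) (i 1) * Equiv.swap (i 1) (i 2)) z =
      Equiv.swap (i 0) (i 1) (Equiv.swap (i 1) (i 2) z) := fun z => rfl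
  refine ⟨Equiv.swap (i 0) (i 1) * Equiv.swap (i 1) (i 2), ?_, fun h hh h1 hc => ?_⟩
  · rw [Equiv.Perm.mem_alternatingGroup, map_mul, Equiv.Perm.sign_swap (hi (by decide)),
      Equiv.Perm.sign_swap (hi (by decide))]
    rfl
  set g := Equiv.swap (i 0) (i 1) * Equiv.swap (i 1) (i 2)
  have hy : ∀ z, (g * h * g⁻¹) (g z) = g (h z) := fun z => by simp
  have g0 : g (i 0) = i 1 := by simp [hg, i, Equiv.swap_apply_def]
  have g1 : g (i 1) = i 2 := by simp [hg, i, Equiv.swap_apply_def]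
  have g2 : g (i 2) = i 0 := by simp [hg, i]
  have g3 : g (i 3) = i 3 := by simp [hg, i, Equiv.swap_apply_def]
  have hs := hstab _ hc
  rcases mem_twoTranspositions hh with h2 | h2 | h2 | h2
  · exact h1 h2
  · have h3 : h (i 0) = i 1 := by simp [h2, firstTransposition, i]
    have h4 := hy (i 0)
    rw [g0, h3, g1] at h4
    rw [h4] at hs
    exact hs.2.elim (hi (by decide)) (hi (by decide))
  · have h3 : h (i 2) = i 3 := by simp [h2, secondTransposition, i]
    have h4 := hy (i 2)
    rw [g2, h3, g3] at h4
    rw [h4] at hs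
    exact hs.1.elim (hi (by decide)) (hi (by decide))
  · have h3 : h (i 0) = i 1 := by
      simp [h2, firstTransposition, secondTransposition, i, Equiv.swap_apply_def]
    have h4 := hy (i 0)
    rw [g0, h3, g1] at h4
    rw [h4] at hs
    exact hs.2.elim (hi (by decide)) (hi (by decide))

/-- The sign character of the symmetric group with values in a field. -/
def signChar (k α : Type*) [Field k] [Fintype α] [DecidableEq α] : CharGroup k (Equiv.Perm α) :=
  (Units.map (Int.castRingHom k).toMonoidHom).comp Equiv.Perm.sign

theorem signChar_swap {k α : Type*} [Field k] [Fintype α] [DecidableEq α] {x y : α} (h : x ≠ y) :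
    signChar k α (Equiv.swap x y) = -1 := by
  ext
  simp [signChar, Equiv.Perm.sign_swap h]

theorem isTwoCoboundary_of_symm_at_signChar {k : Type*} [Field k] [IsAlgClosed k] [CharZero k]
    (n : ℕ) (hn : 4 ≤ n) {ω : CharGroup k (twoTranspositions n hn) →
      CharGroup k (twoTranspositions n hn) → kˣ} (hω : IsNormalizedTwoCocycle ω)
    (hsymm : ∀ α, ω ((signChar k (Fin n)).comp (twoTranspositions n hn).subtype) α =
      ω α ((signChar k (Fin n)).comp (twoTranspositions n hn).subtype)) : IsTwoCoboundary ω := by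
  refine isTwoCoboundary_of_symm_at_sign (a := ⟨_, firstTransposition_mem n hn⟩)
    (b := ⟨_, secondTransposition_mem n hn⟩) (Subtype.ext (Equiv.swap_mul_self _ _))
    (Subtype.ext (Equiv.swap_mul_self _ _)) ?_ ?_ (signChar_swap (by simp)) (signChar_swap (by simp))
    hω hsymm
  · intro h
    have h1 := congrArg (fun x : Equiv.Perm (Fin n) => x ⟨0, by omega⟩) (congrArg Subtype.val h)
    simp [firstTransposition, secondTransposition, Equiv.swap_apply_def] at h1
  · rintro ⟨x, hx⟩
    simpa [Subtype.ext_iff] using mem_twoTranspositions hx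

/-! ### Simplicity of the twisted group algebra. -/

section Simplicity

open TensorProduct

variable {k A : Type*} [Field k] [Ring A] [HopfAlgebra k A]

/-- A normal Hopf subalgebra of a twist `A^J` with involutive antipodes contains an idempotent that
is central in `A` and whose coproduct in `A` satisfies `Δ(e) (1 ⊗ e) = e ⊗ e`. -/
theorem HopfTwist.exists_central_integral [CharZero k] [FiniteDimensional k A] (T : HopfTwist k A)
    (hS : ∀ a : A, HopfAlgebra.antipode k (HopfAlgebra.antipode k a) = a)
    (hv : HopfAlgebra.antipode k T.v = T.v) (K : HopfSubalgebra k T.Twisted) (hK : K.IsNormal) :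
    ∃ e : A, e ∈ (K.toSubalgebra : Set T.Twisted) ∧ Coalgebra.counit (R := k) e = 1 ∧
      (∀ x : A, x ∈ (K.toSubalgebra : Set T.Twisted) → x * e = Coalgebra.counit (R := k) x • e) ∧
      (∀ a, a * e = e * a) ∧ Coalgebra.comul (R := k) e * (1 ⊗ₜ[k] e) = e ⊗ₜ[k] e := by
  have : FiniteDimensional k T.Twisted := ‹FiniteDimensional k A›
  have hS' : ∀ a : T.Twisted, HopfAlgebra.antipode k (HopfAlgebra.antipode k a) = a :=
    T.antipode_antipode hS hv
  obtain ⟨e, he, hε, hSe, hl, hr⟩ := K.exists_integral hS'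
  have hc := K.integral_commute hK hS' he hε hSe hr
  exact ⟨e, he, hε, hl, hc, T.comul_mul_of_commute hc (K.comul_mul_one_tmul_integral hl he)⟩

end Simplicity

theorem mainTheorem3 {k : Type*} [Field k] [IsAlgClosed k] [CharZero k] (n : ℕ) (hn : 5 ≤ n)
    (ω : CharGroup k (twoTranspositions n (Nat.le_of_succ_le hn)) →
      CharGroup k (twoTranspositions n (Nat.le_of_succ_le hn)) → kˣ)
    (hω : IsNormalizedTwoCocycle ω) (hω_nontrivial : ¬ IsTwoCoboundary ω) :
    IsSimpleHopfAlgebra k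
      (abelianTwist k (twoTranspositions n (Nat.le_of_succ_le hn)) ω hω).Twisted := by
  classical
  let T := abelianTwist k (twoTranspositions n (Nat.le_of_succ_le hn)) ω hω
  change IsSimpleHopfAlgebra k T.Twisted
  refine ⟨fun h => ?_, fun K hK => ?_⟩
  · obtain ⟨c, hc⟩ : ∃ c : k, algebraMap k (MonoidAlgebra k (Equiv.Perm (Fin n))) c =
        MonoidAlgebra.single (firstTransposition n (Nat.le_of_succ_le hn)) 1 := by
      have h1 : ∀ x : T.Twisted, x ∈ (⊥ : Subalgebra k T.Twisted) := fun x => h ▸ Algebra.mem_top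
      exact Algebra.mem_bot.1 (h1 _)
    have h2 := congrArg
      (fun x => x.coeff (firstTransposition n (Nat.le_of_succ_le hn))) hc
    have h3 : firstTransposition n (Nat.le_of_succ_le hn) ≠ 1 := by
      simp [firstTransposition, Equiv.swap_eq_one_iff]
    simp [MonoidAlgebra.coe_algebraMap, Finsupp.single_eq_of_ne h3] at h2
  obtain ⟨e, heK, hε, hl, hc, hΔ⟩ := T.exists_central_integral MonoidAlgebra.antipode_antipode
    (antipode_abelianTwist_v _ hω) K hK
  have he0 : e ≠ 0 := by
    rintro rfl
    simp at hε
  have hN := MonoidAlgebra.leftStabilizer_normal hc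
  -- With trivial stabilizer, `e` is supported at `1` and `ε(e) = 1` forces `e = 1`; then `x = x e =
  -- ε(x) 1` for `x ∈ K`.
  by_cases hbot : MonoidAlgebra.leftStabilizer e = ⊥
  · left
    have h1 : e = MonoidAlgebra.single 1 (e.coeff 1) := by
      refine MonoidAlgebra.ext (Finsupp.ext fun g => ?_)
      by_cases hg : g = 1
      · subst hg
        simp
      · rw [MonoidAlgebra.coeff_single, Finsupp.single_eq_of_ne hg]
        by_contra hne
        have := MonoidAlgebra.mem_leftStabilizer_of_coeff_ne_zero hΔ hne
        rw [hbot, Subgroup.mem_bot] at this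
        exact hg this
    have h2 : e = 1 := by
      rw [h1, MonoidAlgebra.counit_single] at hε
      rw [h1, MonoidAlgebra.one_def]
      exact congrArg _ hε
    rw [eq_bot_iff]
    intro x hx
    have h3 : ∀ y : MonoidAlgebra k (Equiv.Perm (Fin n)), y ∈ (K.toSubalgebra : Set T.Twisted) →
        algebraMap k (MonoidAlgebra k (Equiv.Perm (Fin n))) (Coalgebra.counit (R := k) y) = y := by
      intro y hy
      rw [Algebra.algebraMap_eq_smul_one, ← h2, ← hl y hy, h2, mul_one]
    exact Algebra.mem_bot.2 ⟨_, h3 x hx⟩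
  right
  have hcard : 5 ≤ Nat.card (Fin n) := by simpa using hn
  have hAN : alternatingGroup (Fin n) ≤ MonoidAlgebra.leftStabilizer e :=
    Equiv.Perm.alternatingGroup_le_of_normal hcard ((Subgroup.nontrivial_iff_ne_bot _).2 hbot)
  -- The stabilizer already contains `A_n`, so it is `A_n` if it consists of even permutations and
  -- `S_n` otherwise.
  by_cases hNA : MonoidAlgebra.leftStabilizer e ≤ alternatingGroup (Fin n)
  · exfalso
    refine hω_nontrivial (isTwoCoboundary_of_symm_at_signChar n _ hω ?_)
    -- The support of `e` is even, so the sign character and the counit agree on `e`. Applying the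
    -- sign to the leg carrying `e` in `Δ^J(x)(1 ⊗ e) = x ⊗ e` and in its mirror image gives the
    -- invariance of `K` below.
    have hσ : charAlgHom (signChar k (Fin n)) e = 1 := by
      rw [← hε]
      refine MonoidAlgebra.eq_of_forall_coeff_ne_zero
        (charAlgHom (signChar k (Fin n))).toLinearMap (Coalgebra.counit (R := k)) e fun g hg => ?_
      have := hNA (MonoidAlgebra.mem_leftStabilizer_of_coeff_ne_zero hΔ hg)
      rw [Equiv.Perm.mem_alternatingGroup] at this
      simp [signChar, this]
    obtain ⟨g, hg, hgH⟩ := exists_mem_alternatingGroup_conj_notMem n (Nat.le_of_succ_le hn)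
    have hr : ∀ x : MonoidAlgebra k (Equiv.Perm (Fin n)), x ∈ (K.toSubalgebra : Set T.Twisted) →
        HopfTwist.evalRight (charAlgHom (signChar k (Fin n))) (T.comul x) = x := by
      intro x hx
      have h1 : T.comul x * (1 ⊗ₜ[k] e) = x ⊗ₜ[k] e := K.comul_mul_one_tmul_integral hl hx
      have h2 := congrArg (HopfTwist.evalRight (charAlgHom (signChar k (Fin n)))) h1
      simpa [hσ] using h2
    have hl' : ∀ x : MonoidAlgebra k (Equiv.Perm (Fin n)), x ∈ (K.toSubalgebra : Set T.Twisted) →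
        HopfTwist.evalLeft (charAlgHom (signChar k (Fin n))) (T.comul x) = x := by
      intro x hx
      have h1 : T.comul x * (e ⊗ₜ[k] 1) = e ⊗ₜ[k] x := K.comul_mul_integral_tmul_one hl hx
      have h2 := congrArg (HopfTwist.evalLeft (charAlgHom (signChar k (Fin n)))) h1
      simpa [hσ] using h2
    obtain ⟨t, ht⟩ := K.exists_comul_eq_sum heK
    exact cocycle_symm_of_invariant _ hω _ (t := t) (x := fun p => p.1.1) (y := fun p => p.2.1) ht
      (fun p _ => hr _ p.1.2) (fun p _ => hl' _ p.1.2)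
      (MonoidAlgebra.coeff_ne_zero_of_mem_leftStabilizer he0 hΔ (hAN hg)) hgH
  · have htop : ∀ g, g ∈ MonoidAlgebra.leftStabilizer e := by
      obtain ⟨u, hu, huA⟩ := SetLike.not_le_iff_exists.1 hNA
      have hsu : Equiv.Perm.sign u = -1 :=
        (Int.units_eq_one_or _).resolve_left fun h => huA (Equiv.Perm.mem_alternatingGroup.2 h)
      intro g
      rcases Int.units_eq_one_or (Equiv.Perm.sign g) with h | h
      · exact hAN (Equiv.Perm.mem_alternatingGroup.2 h)
      · have h1 : u⁻¹ * g ∈ MonoidAlgebra.leftStabilizer e :=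
          hAN (Equiv.Perm.mem_alternatingGroup.2 (by simp [h, hsu]))
        simpa using mul_mem hu h1
    refine K.eq_top_of_integral_mem (Λ := (e : T.Twisted)) (fun a => ?_) hε heK
    -- Every group element fixes `e`, so by linearity `e` is a left integral of the whole algebra.
    have key : ∀ a : MonoidAlgebra k (Equiv.Perm (Fin n)),
        a * e = Coalgebra.counit (R := k) a • e := fun a =>
      MonoidAlgebra.eq_of_forall_coeff_ne_zero (LinearMap.mulRight k e)
        ((Coalgebra.counit (R := k)).smulRight e) a fun g _ => by
          simpa using MonoidAlgebra.mem_leftStabilizer.1 (htop g)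
    exact key a
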